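/- All rings are commutative with unit. Let $R$ be a ring and $r\in R$ such that $R$ is $r$-torsion-free and $r$-adically complete and separated. For an $R$-module $M$ write $M[r^n]=\{m\in M : r^n m=0\}$. A finite projective module over a ring $A$ has constant rank if its rank function on $\mathrm{Spec}(A)$ is constant. One says that $M$ has finite projective $(r,\mu)$-dévissage (resp. $(r,\tau)$-dévissage) if for every $n\ge 0$ the subquotient $r^nM/r^{n+1}M$ (resp. $M[r^{n+1}]/M[r^n]$) is a finite projective $R/r$-module of constant rank. It has bounded $r^\infty$-torsion if there is $N$ with $M[r^n]\subseteq M[r^N]$ for all $n$. For every $R$-module $M$ the following are equivalent: (i) $M$ is $r$-adically complete and separated and has finite projective $(r,\mu)$-dévissage; (ii) $M$ is finitely presented, has finite projective $(r,\mu)$-dévissage and has bounded $r^\infty$-torsion; (iii) there exist $N\ge 1$, a finite projective $R$-module $M_\infty$ of constant rank, and an $R$-module $M_{\mathrm{tors}}$ with $r^N M_{\mathrm{tors}}=0$ and with finite projective $(r,\mu)$-dévissage, such that $M\cong M_\infty\oplus M_{\mathrm{tors}}$. Moreover, if $M$ satisfies these conditions, then $\mathrm{Tor}_1^R(M,P)=0$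 for every $R$-module $P$ with $P[r]=0$, and $M$ has finite projective $(r,\tau)$-dévissage. Suppose in addition that $K_0(R/r)=\mathbb{Z}$, i.e. that every finite projective $R/r$-module is stably free (equivalently, the canonical map $\mathbb{Z}\to K_0(R/r)$, $n\mapsto n[R/r]$, is surjective). Then the three conditions on $M$ are also equivalent to: (iv) there exist $N\ge 1$ and an isomorphism $M\cong M_\infty\oplus\bigoplus_{1\le n\le N}M_n$, where $M_\infty$ is a finite projective $R$-module of constant rank and each $M_n$ is a finite projective $R/r^n$-module of constant rank. -/

import Mathlib

universe u

/-- `(R, r)` is a *dévissage setup*: `R` is `r`-torsion-free, `r`-adically complete and separated.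
(Mathlib's `IsAdicComplete` comprises separatedness.) -/
structure IsDevissageSetup (R : Type u) [CommRing R] (r : R) : Prop where
  torsion_free : Submodule.torsionBy R R r = ⊥
  complete : IsAdicComplete (Ideal.span {r}) R

/-- `Q` is a finite projective `A`-module of constant rank over `Spec A`. -/
def IsFiniteProjectiveOfConstantRank (A : Type u) [CommRing A] (Q : Type u) [AddCommGroup Q]
    [Module A Q] : Prop :=
  Module.Finite A Q ∧ Module.Projective A Q ∧
    ∃ d : ℕ, ∀ p : PrimeSpectrum A, Module.rankAtStalk Q p = d

/-- The `R`-module `Q` is killed by the ideal `I`, and it is finite projective of constant rank for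
its induced (unique compatible) structure of `R ⧸ I`-module. -/
def IsFiniteProjectiveOfConstantRankOverQuotient {R : Type u} [CommRing R] (I : Ideal R)
    (Q : Type u) [AddCommGroup Q] [Module R Q] : Prop :=
  ∃ h : Module.IsTorsionBySet R Q I,
    letI : Module (R ⧸ I) Q := h.module
    IsFiniteProjectiveOfConstantRank (R ⧸ I) Q

/-- The submodule `r ^ n M` of `M`. -/
def powMul {R : Type u} [CommRing R] (r : R) (M : Type u) [AddCommGroup M] [Module R M] (n : ℕ) :
    Submodule R M :=
  LinearMap.range (LinearMap.lsmul R M (r ^ n))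

/-- The subquotient `r ^ n M / r ^ (n + 1) M`. -/
abbrev MuSubquotient {R : Type u} [CommRing R] (r : R) (M : Type u) [AddCommGroup M] [Module R M]
    (n : ℕ) : Type u :=
  ↥(powMul r M n) ⧸ (powMul r M (n + 1)).submoduleOf (powMul r M n)

/-- The subquotient `M[r ^ (n + 1)] / M[r ^ n]`. -/
abbrev TauSubquotient {R : Type u} [CommRing R] (r : R) (M : Type u) [AddCommGroup M] [Module R M]
    (n : ℕ) : Type u :=
  ↥(Submodule.torsionBy R M (r ^ (n + 1))) ⧸
    (Submodule.torsionBy R M (r ^ n)).submoduleOf (Submodule.torsionBy R M (r ^ (n + 1)))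

/-- The subquotient `r ^ n M / r ^ (n + 1) M` is killed by `r`. -/
theorem muSubquotient_isTorsionBySet {R : Type u} [CommRing R] (r : R) (M : Type u)
    [AddCommGroup M] [Module R M] (n : ℕ) :
    Module.IsTorsionBySet R (MuSubquotient r M n) (Ideal.span {r} : Ideal R) := by
  rw [Module.isTorsionBySet_span_singleton_iff]
  intro x
  obtain ⟨⟨y, m, rfl⟩, rfl⟩ := Submodule.Quotient.mk_surjective _ x
  rw [← Submodule.Quotient.mk_smul, Submodule.Quotient.mk_eq_zero]
  exact ⟨m, by simp [pow_succ', mul_smul]⟩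

/-- The subquotient `M[r ^ (n + 1)] / M[r ^ n]` is killed by `r`. -/
theorem tauSubquotient_isTorsionBySet {R : Type u} [CommRing R] (r : R) (M : Type u)
    [AddCommGroup M] [Module R M] (n : ℕ) :
    Module.IsTorsionBySet R (TauSubquotient r M n) (Ideal.span {r} : Ideal R) := by
  rw [Module.isTorsionBySet_span_singleton_iff]
  intro x
  obtain ⟨⟨y, hy⟩, rfl⟩ := Submodule.Quotient.mk_surjective _ x
  rw [← Submodule.Quotient.mk_smul, Submodule.Quotient.mk_eq_zero]
  simpa [Submodule.submoduleOf, pow_succ, mul_smul] using hy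

/-- *Finite projective `(r, μ)`-dévissage*: each `r ^ n M / r ^ (n + 1) M` is a finite projective
`R / r`-module of constant rank. -/
def HasMuDevissage {R : Type u} [CommRing R] (r : R) (M : Type u) [AddCommGroup M] [Module R M] :
    Prop :=
  ∀ n : ℕ, IsFiniteProjectiveOfConstantRankOverQuotient (Ideal.span {r}) (MuSubquotient r M n)

/-- *Finite projective `(r, τ)`-dévissage*: each `M[r ^ (n + 1)] / M[r ^ n]` is a finite projective
`R / r`-module of constant rank. -/
def HasTauDevissage {R : Type u} [CommRing R] (r : R) (M : Type u) [AddCommGroup M] [Module R M] :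
    Prop :=
  ∀ n : ℕ, IsFiniteProjectiveOfConstantRankOverQuotient (Ideal.span {r}) (TauSubquotient r M n)

/-- `M` has *bounded `r^∞`-torsion*: some `r ^ N` kills every element killed by a power of `r`. -/
def HasBoundedTorsion {R : Type u} [CommRing R] (r : R) (M : Type u) [AddCommGroup M]
    [Module R M] : Prop :=
  ∃ N : ℕ, ∀ n : ℕ, Submodule.torsionBy R M (r ^ n) ≤ Submodule.torsionBy R M (r ^ N)

/-- `M ≅ M_∞ ⊕ M_tors` with `M_∞` finite projective of constant rank over `R`, and `M_tors` an
`r ^ N`-torsion module with finite projective `(r, μ)`-dévissage, for some `N ≥ 1`. -/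
def HasTorsionDecomposition {R : Type u} [CommRing R] (r : R) (M : Type u) [AddCommGroup M]
    [Module R M] : Prop :=
  ∃ (N : ℕ) (_ : 1 ≤ N)
    (Minf : Type u) (_ : AddCommGroup Minf) (_ : Module R Minf)
    (Mtors : Type u) (_ : AddCommGroup Mtors) (_ : Module R Mtors),
    IsFiniteProjectiveOfConstantRank R Minf ∧
    Module.IsTorsionBy R Mtors (r ^ N) ∧ HasMuDevissage r Mtors ∧
    Nonempty (M ≃ₗ[R] Minf × Mtors)

/-- `M ≅ M_∞ ⊕ ⨁_{1 ≤ n ≤ N} M_n` with `M_∞` finite projective of constant rank over `R`, and `M_n`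
finite projective of constant rank over `R / r ^ n`, for some `N ≥ 1`. -/
def HasFullDecomposition {R : Type u} [CommRing R] (r : R) (M : Type u) [AddCommGroup M]
    [Module R M] : Prop :=
  ∃ (N : ℕ) (_ : 1 ≤ N)
    (Minf : Type u) (_ : AddCommGroup Minf) (_ : Module R Minf)
    (Mfin : Finset.Icc 1 N → Type u) (_ : ∀ n, AddCommGroup (Mfin n)) (_ : ∀ n, Module R (Mfin n)),
    IsFiniteProjectiveOfConstantRank R Minf ∧
    (∀ n : Finset.Icc 1 N,
      IsFiniteProjectiveOfConstantRankOverQuotient (Ideal.span {r ^ (n : ℕ)}) (Mfin n)) ∧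
    Nonempty (M ≃ₗ[R] Minf × DirectSum (Finset.Icc 1 N) Mfin)

/-- Finite projective `A`-modules. -/
structure FinProjModule (A : Type u) [CommRing A] where
  carrier : Type u
  [addCommGroup : AddCommGroup carrier]
  [module : Module A carrier]
  [finite : Module.Finite A carrier]
  [projective : Module.Projective A carrier]

attribute [instance] FinProjModule.addCommGroup FinProjModule.module FinProjModule.finite
  FinProjModule.projective

/-- Isomorphism of finite projective modules. -/
instance FinProjModule.setoid (A : Type u) [CommRing A] : Setoid (FinProjModule A) where
  r P Q := Nonempty (P.carrier ≃ₗ[A] Q.carrier)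
  iseqv :=
    ⟨fun _ => ⟨LinearEquiv.refl A _⟩, fun ⟨e⟩ => ⟨e.symm⟩, fun ⟨e⟩ ⟨f⟩ => ⟨e.trans f⟩⟩

/-- Isomorphism classes of finite projective `A`-modules. -/
def FinProjClass (A : Type u) [CommRing A] : Type (u + 1) :=
  Quotient (FinProjModule.setoid A)

/-- The isomorphism class of a finite projective `A`-module. -/
def FinProjClass.mk (A : Type u) [CommRing A] (P : Type u) [AddCommGroup P] [Module A P]
    [Module.Finite A P] [Module.Projective A P] : FinProjClass A :=
  Quotient.mk (FinProjModule.setoid A) ⟨P⟩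

/-- Addition of isomorphism classes is induced by `⊕`. -/
instance FinProjClass.add (A : Type u) [CommRing A] : Add (FinProjClass A) where
  add := Quotient.map₂ (fun P Q => ⟨P.carrier × Q.carrier⟩)
    fun _ _ ⟨e⟩ _ _ ⟨f⟩ => ⟨LinearEquiv.prodCongr e f⟩

instance FinProjClass.zero (A : Type u) [CommRing A] : Zero (FinProjClass A) where
  zero := FinProjClass.mk A PUnit

/-- Isomorphism classes of finite projective modules form a commutative monoid under `⊕`. -/
instance FinProjClass.addCommMonoid (A : Type u) [CommRing A] : AddCommMonoid (FinProjClass A) where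
  add_assoc := by
    rintro ⟨P⟩ ⟨Q⟩ ⟨S⟩
    exact Quotient.sound ⟨LinearEquiv.prodAssoc A _ _ _⟩
  zero_add := by
    rintro ⟨P⟩
    exact Quotient.sound ⟨LinearEquiv.uniqueProd⟩
  add_zero := by
    rintro ⟨P⟩
    exact Quotient.sound ⟨LinearEquiv.prodUnique⟩
  add_comm := by
    rintro ⟨P⟩ ⟨Q⟩
    exact Quotient.sound ⟨LinearEquiv.prodComm A _ _⟩
  nsmul := nsmulRec

/-- `K₀(A)`: the Grothendieck group of the monoid of isomorphism classes of finite projective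
`A`-modules. -/
abbrev K0 (A : Type u) [CommRing A] : Type (u + 1) :=
  Algebra.GrothendieckAddGroup (FinProjClass A)

/-- The canonical map `ℤ → K₀(A)`, `n ↦ n [A]`. -/
def K0.ofInt (A : Type u) [CommRing A] : ℤ →+ K0 A :=
  zmultiplesHom (K0 A) (Algebra.GrothendieckAddGroup.of (FinProjClass.mk A A))

/-- `K₀(A) = ℤ`, in the sense that every finite projective `A`-module is stably free: the canonical
map `ℤ → K₀(A)` is onto. For `A ≠ 0` this map is always injective (look at ranks at a prime), so it
is then an isomorphism; the zero ring, over which every module is free, is allowed. -/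
def K0EqInt (A : Type u) [CommRing A] : Prop :=
  Function.Surjective (K0.ofInt A)

/-! Write `gr^n` for `r^n M / r^(n+1) M`. Multiplication by `r` gives surjections `gr^n → gr^(n+1)`
of projective `R/r`-modules of constant rank, so the ranks decrease and become stationary, and a
surjection between equal ranks is bijective (`eventually_injective`). If `M` is separated, an
element killed by `r^(N+1)`, for `N` large, then has `r^N m` divisible by every power of `r`, hence
zero: the torsion is bounded (`HasMuDevissage.hasBoundedTorsion`). Separatedness also makes `M`
finite, since `M/rM` is.

For a finite `M` with bounded torsion, `r^(N+1) M` is torsion-free and projective modulo `r`.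
Comparing it with a projective lift of its reduction, obtained by lifting an idempotent matrix,
shows that it is projective. Thus `M → r^(N+1) M` splits, and ranks cancel in the kernel
(`HasMuDevissage.hasTorsionDecomposition`).

A torsion `M` is analysed by induction through `rM`, whose graded pieces are those of `M` shifted by
one (`exists_generators_of_pow_smul_eq_zero`): it is a sum of modules `P/r^n P`. This gives the full
decomposition and a resolution of length one by finite projectives, whose differential has a left
inverse up to `r^N`. Finite presentation and the vanishing of `Tor` are read off from it. The
`τ`-dévissage comes from filtering `M[r]` by the `M[r] ∩ r^n M`, whose successive quotients are the
kernels of `gr^n → gr^(n+1)`. -/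

namespace IsFiniteProjectiveOfConstantRank

/-! ### Sums and cancellation for projective modules of constant rank -/

variable {A : Type u} [CommRing A] {P Q : Type u} [AddCommGroup P] [Module A P]
  [AddCommGroup Q] [Module A Q]

theorem congr (e : P ≃ₗ[A] Q) (h : IsFiniteProjectiveOfConstantRank A P) :
    IsFiniteProjectiveOfConstantRank A Q := by
  obtain ⟨hf, hp, d, hd⟩ := h
  refine ⟨Module.Finite.equiv e, Module.Projective.of_equiv e, d, fun p => ?_⟩
  rw [← Module.rankAtStalk_eq_of_equiv e, hd]

theorem of_subsingleton [Subsingleton P] : IsFiniteProjectiveOfConstantRank A P :=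
  ⟨inferInstance, inferInstance, 0, fun p => by
    rw [Module.rankAtStalk_eq_zero_of_subsingleton]; rfl⟩

theorem prod (hP : IsFiniteProjectiveOfConstantRank A P)
    (hQ : IsFiniteProjectiveOfConstantRank A Q) : IsFiniteProjectiveOfConstantRank A (P × Q) := by
  obtain ⟨_, _, d, hd⟩ := hP
  obtain ⟨_, _, e, he⟩ := hQ
  refine ⟨inferInstance, inferInstance, d + e, fun p => ?_⟩
  rw [Module.rankAtStalk_prod, Pi.add_apply, hd, he]

theorem pi {ι : Type} [Finite ι] {P : ι → Type u} [∀ i, AddCommGroup (P i)]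
    [∀ i, Module A (P i)] (hP : ∀ i, IsFiniteProjectiveOfConstantRank A (P i)) :
    IsFiniteProjectiveOfConstantRank A (∀ i, P i) := by
  have h1 : ∀ i, Module.Finite A (P i) := fun i => (hP i).1
  have h2 : ∀ i, Module.Projective A (P i) := fun i => (hP i).2.1
  choose d hd using fun i => (hP i).2.2
  have h3 : Module.Projective A (∀ i, P i) := by
    classical
    have := Fintype.ofFinite ι
    exact Module.Projective.of_equiv (DirectSum.linearEquivFunOnFintype A ι P)
  refine ⟨inferInstance, h3, ∑ᶠ i, d i, fun p => ?_⟩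
  rw [Module.rankAtStalk_pi]
  exact finsum_congr fun i => hd i p

/-- Ranks add, so the complement has rank `e - d`. Through this cancellation, constancy of the rank
passes to kernels of surjections. -/
theorem of_prod (hP : IsFiniteProjectiveOfConstantRank A P)
    (h : IsFiniteProjectiveOfConstantRank A (P × Q)) : IsFiniteProjectiveOfConstantRank A Q := by
  obtain ⟨_, _, d, hd⟩ := hP
  obtain ⟨_, _, e, he⟩ := h
  have : Module.Projective A Q :=
    Module.Projective.of_split (LinearMap.inr A P Q) (LinearMap.snd A P Q) (by ext; rfl)
  have : Module.Finite A Q :=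
    Module.Finite.of_surjective (LinearMap.snd A P Q) Prod.snd_surjective
  refine ⟨this, inferInstance, e - d, fun p => ?_⟩
  have h1 := he p
  rw [Module.rankAtStalk_prod, Pi.add_apply, hd] at h1
  omega

end IsFiniteProjectiveOfConstantRank

/-! ### Projective modules over a quotient ring, seen as `R`-modules -/

namespace IsFiniteProjectiveOfConstantRankOverQuotient

variable {R : Type u} [CommRing R] {I : Ideal R} {P Q : Type u} [AddCommGroup P] [Module R P]
  [AddCommGroup Q] [Module R Q]

/-- The `R ⧸ I`-structure is determined by the `R`-structure, so the chosen `h.module` can be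
exchanged for any compatible instance. -/
theorem iff_of_isScalarTower [Module (R ⧸ I) Q] [IsScalarTower R (R ⧸ I) Q] :
    IsFiniteProjectiveOfConstantRankOverQuotient I Q ↔
      IsFiniteProjectiveOfConstantRank (R ⧸ I) Q := by
  have key : ∀ h : Module.IsTorsionBySet R Q I,
      h.module = (inferInstance : Module (R ⧸ I) Q) := by
    intro h
    refine Module.ext' _ _ fun a x => ?_
    obtain ⟨a, rfl⟩ := Ideal.Quotient.mk_surjective a
    rw [h.mk_smul]
    exact (algebraMap_smul (R ⧸ I) a x).symm
  constructor
  · rintro ⟨h, h1⟩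
    rwa [key h] at h1
  · intro h1
    have h : Module.IsTorsionBySet R Q I := by
      rintro x ⟨a, ha⟩
      change a • x = 0
      rw [← algebraMap_smul (R ⧸ I) a x, Ideal.Quotient.algebraMap_eq,
        Ideal.Quotient.eq_zero_iff_mem.2 ha, zero_smul]
    refine ⟨h, ?_⟩
    rwa [key h]

theorem congr (e : P ≃ₗ[R] Q) (hP : IsFiniteProjectiveOfConstantRankOverQuotient I P) :
    IsFiniteProjectiveOfConstantRankOverQuotient I Q := by
  obtain ⟨h, h1⟩ := hP
  have h' : Module.IsTorsionBySet R Q I := fun x a => e.symm.injective <| by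
    rw [map_smul, map_zero]; exact h (a := a)
  let _ := h.module
  let _ := h'.module
  exact iff_of_isScalarTower.2 (h1.congr (e.extendScalarsOfSurjective Ideal.Quotient.mk_surjective))

theorem of_subsingleton [Subsingleton P] : IsFiniteProjectiveOfConstantRankOverQuotient I P := by
  have h : Module.IsTorsionBySet R P I := fun _ _ => Subsingleton.elim _ _
  let _ := h.module
  exact iff_of_isScalarTower.2 IsFiniteProjectiveOfConstantRank.of_subsingleton

theorem prod (hP : IsFiniteProjectiveOfConstantRankOverQuotient I P)
    (hQ : IsFiniteProjectiveOfConstantRankOverQuotient I Q) :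
    IsFiniteProjectiveOfConstantRankOverQuotient I (P × Q) := by
  obtain ⟨h, h1⟩ := hP
  obtain ⟨h', h1'⟩ := hQ
  let _ := h.module
  let _ := h'.module
  exact iff_of_isScalarTower.2 (h1.prod h1')

theorem pi {ι : Type} [Finite ι] {P : ι → Type u} [∀ i, AddCommGroup (P i)]
    [∀ i, Module R (P i)] (hP : ∀ i, IsFiniteProjectiveOfConstantRankOverQuotient I (P i)) :
    IsFiniteProjectiveOfConstantRankOverQuotient I (∀ i, P i) := by
  choose h h1 using hP
  let := fun i => (h i).module
  exact iff_of_isScalarTower.2 (IsFiniteProjectiveOfConstantRank.pi h1)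

theorem of_prod (hP : IsFiniteProjectiveOfConstantRankOverQuotient I P)
    (h : IsFiniteProjectiveOfConstantRankOverQuotient I (P × Q)) :
    IsFiniteProjectiveOfConstantRankOverQuotient I Q := by
  have hQ : Module.IsTorsionBySet R Q I := fun x a => by
    simpa using congrArg Prod.snd (h.1 (x := ((0 : P), x)) (a := a))
  obtain ⟨hP1, hP2⟩ := hP
  let := hP1.module
  let := hQ.module
  exact iff_of_isScalarTower.2 (hP2.of_prod (iff_of_isScalarTower.1 h))

/-- A linear map onto a finite projective `R ⧸ I`-module from an `R ⧸ I`-module splits. -/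
theorem exists_section (hP : Module.IsTorsionBySet R P I)
    (hQ : IsFiniteProjectiveOfConstantRankOverQuotient I Q) (g : P →ₗ[R] Q)
    (hg : Function.Surjective g) : ∃ s : Q →ₗ[R] P, g ∘ₗ s = LinearMap.id := by
  obtain ⟨h, _, _, _⟩ := hQ
  let _ := h.module
  let := hP.module
  obtain ⟨s, hs⟩ := Module.projective_lifting_property
    (g.extendScalarsOfSurjective (S := R ⧸ I) Ideal.Quotient.mk_surjective)
    LinearMap.id hg
  exact ⟨s.restrictScalars R, LinearMap.ext fun x => LinearMap.congr_fun hs x⟩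

theorem exists_equiv_prod_ker (hP : Module.IsTorsionBySet R P I)
    (hQ : IsFiniteProjectiveOfConstantRankOverQuotient I Q) (g : P →ₗ[R] Q)
    (hg : Function.Surjective g) : Nonempty ((LinearMap.ker g × Q) ≃ₗ[R] P) := by
  obtain ⟨s, hs⟩ := exists_section hP hQ g hg
  exact ⟨lequivProdOfRightSplitExact (j := (LinearMap.ker g).subtype) (g := g) (f := s)
    Subtype.val_injective (by simp) hs⟩

theorem ker (hP : IsFiniteProjectiveOfConstantRankOverQuotient I P)
    (hQ : IsFiniteProjectiveOfConstantRankOverQuotient I Q) (g : P →ₗ[R] Q)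
    (hg : Function.Surjective g) :
    IsFiniteProjectiveOfConstantRankOverQuotient I (LinearMap.ker g) := by
  obtain ⟨e⟩ := exists_equiv_prod_ker hP.1 hQ g hg
  exact of_prod hQ (hP.congr (e.symm.trans (LinearEquiv.prodComm R _ _)))

theorem of_ker (hP : Module.IsTorsionBySet R P I)
    (hQ : IsFiniteProjectiveOfConstantRankOverQuotient I Q) (g : P →ₗ[R] Q)
    (hg : Function.Surjective g)
    (hK : IsFiniteProjectiveOfConstantRankOverQuotient I (LinearMap.ker g)) :
    IsFiniteProjectiveOfConstantRankOverQuotient I P := by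
  obtain ⟨e⟩ := exists_equiv_prod_ker hP hQ g hg
  exact (hK.prod hQ).congr e

theorem finite (hP : IsFiniteProjectiveOfConstantRankOverQuotient I P) : Module.Finite R P := by
  obtain ⟨h, _, _, _⟩ := hP
  let _ := h.module
  exact Module.Finite.trans (R ⧸ I) P

/-- In a sequence of surjections of finite projective modules of constant rank over `R ⧸ I`, all but
finitely many of the maps are bijective. -/
theorem eventually_injective {G : ℕ → Type u} [∀ n, AddCommGroup (G n)] [∀ n, Module R (G n)]
    (hG : ∀ n, IsFiniteProjectiveOfConstantRankOverQuotient I (G n))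
    (f : ∀ n, G n →ₗ[R] G (n + 1)) (hf : ∀ n, Function.Surjective (f n)) :
    ∃ N, ∀ n, N ≤ n → Function.Injective (f n) := by
  choose h h1 using hG
  let := fun n => (h n).module
  have hfin : ∀ n, Module.Finite (R ⧸ I) (G n) := fun n => (h1 n).1
  have hproj : ∀ n, Module.Projective (R ⧸ I) (G n) := fun n => (h1 n).2.1
  choose d hd using fun n => (h1 n).2.2
  let F := fun n => (f n).extendScalarsOfSurjective (S := R ⧸ I) Ideal.Quotient.mk_surjective
  have hF : ∀ n, Function.Surjective (F n) := hf
  rcases subsingleton_or_nontrivial (R ⧸ I) with hs | hs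
  -- Over the zero ring there is no prime at which to compare ranks, but all modules vanish.
  · exact ⟨0, fun n _ =>
      have := Module.subsingleton (R ⧸ I) (G n)
      Function.injective_of_subsingleton _⟩
  obtain ⟨p⟩ : Nonempty (PrimeSpectrum (R ⧸ I)) := inferInstance
  -- The surjection splits, so the rank drops by exactly the rank of its kernel.
  have hanti : Antitone d := antitone_nat_of_succ_le fun n => by
    obtain ⟨s, hs⟩ := Module.projective_lifting_property (F n) LinearMap.id (hF n)
    let e := lequivProdOfRightSplitExact (j := (LinearMap.ker (F n)).subtype) (g := F n) (f := s)
      Subtype.val_injective (by simp) hs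
    have hK : Module.Projective (R ⧸ I) (LinearMap.ker (F n)) :=
      Module.Projective.of_split (e.toLinearMap ∘ₗ LinearMap.inl _ _ _)
        (LinearMap.fst _ _ _ ∘ₗ e.symm.toLinearMap) (by ext; simp)
    have hK' : Module.Finite (R ⧸ I) (LinearMap.ker (F n)) :=
      Module.Finite.of_surjective (LinearMap.fst _ _ _ ∘ₗ e.symm.toLinearMap)
        (Prod.fst_surjective.comp e.symm.surjective)
    have h2 := congrFun (Module.rankAtStalk_eq_of_equiv e) p
    rw [Module.rankAtStalk_prod, Pi.add_apply, hd, hd] at h2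
    omega
  obtain ⟨N, hN⟩ := WellFoundedLT.antitone_chain_condition hanti
  refine ⟨N, fun n hn => ?_⟩
  refine (Module.bijective_of_surjective_of_rankAtStalk_eq (hF n) fun m _ => ?_).1
  rw [hd, hd]
  simpa using (hN n hn).symm.trans (hN (n + 1) (hn.trans n.le_succ))

end IsFiniteProjectiveOfConstantRankOverQuotient

/-! ### Reduction modulo an ideal and ranks -/

open TensorProduct in
/-- The base change of `P` to `R ⧸ I`, computed by a surjection with kernel `I P`. -/
theorem nonempty_quotient_tensor_equiv {R : Type u} [CommRing R] {I : Ideal R} {P Q : Type u}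
    [AddCommGroup P] [Module R P] [AddCommGroup Q] [Module R Q] (π : P →ₗ[R] Q)
    (hπ : Function.Surjective π) (hker : LinearMap.ker π = I • ⊤) :
    Nonempty (((R ⧸ I) ⊗[R] P) ≃ₗ[R] Q) :=
  ⟨quotTensorEquivQuotSMul P I ≪≫ₗ Submodule.quotEquivOfEq _ _ hker.symm ≪≫ₗ
    π.quotKerEquivOfSurjective hπ⟩

theorem IsFiniteProjectiveOfConstantRank.quotient {R : Type u} [CommRing R] {I : Ideal R}
    {P Q : Type u} [AddCommGroup P] [Module R P] [AddCommGroup Q] [Module R Q]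
    (hP : IsFiniteProjectiveOfConstantRank R P) (π : P →ₗ[R] Q)
    (hπ : Function.Surjective π) (hker : LinearMap.ker π = I • ⊤) :
    IsFiniteProjectiveOfConstantRankOverQuotient I Q := by
  obtain ⟨e⟩ := nonempty_quotient_tensor_equiv π hπ hker
  obtain ⟨_, _, d, hd⟩ := hP
  refine IsFiniteProjectiveOfConstantRankOverQuotient.congr e
    (IsFiniteProjectiveOfConstantRankOverQuotient.iff_of_isScalarTower.2
      ⟨inferInstance, inferInstance, d, fun p => ?_⟩)
  rw [Module.rankAtStalk_baseChange, hd]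

theorem IsFiniteProjectiveOfConstantRankOverQuotient.of_quotient {R : Type u} [CommRing R]
    {I : Ideal R} (hI : I ≤ (⊥ : Ideal R).jacobson)
    {P Q : Type u} [AddCommGroup P] [Module R P] [AddCommGroup Q] [Module R Q]
    [Module.Finite R P] [Module.Projective R P]
    (hQ : IsFiniteProjectiveOfConstantRankOverQuotient I Q) (π : P →ₗ[R] Q)
    (hπ : Function.Surjective π) (hker : LinearMap.ker π = I • ⊤) :
    IsFiniteProjectiveOfConstantRank R P := by
  obtain ⟨e⟩ := nonempty_quotient_tensor_equiv π hπ hker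
  obtain ⟨_, _, d, hd⟩ :=
    IsFiniteProjectiveOfConstantRankOverQuotient.iff_of_isScalarTower.1 (hQ.congr e.symm)
  refine ⟨inferInstance, inferInstance, d, fun p => ?_⟩
  -- The rank at `p` equals the rank at a maximal ideal `m` above it; as `I` lies in the Jacobson
  -- radical, `m` contains `I` and its rank is visible modulo `I`.
  obtain ⟨m, hm, hpm⟩ := Ideal.exists_le_maximal p.asIdeal p.isPrime.ne_top
  have hIm : I ≤ m := hI.trans (sInf_le ⟨bot_le, hm⟩)
  have hq : (m.map (Ideal.Quotient.mk I)).IsPrime :=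
    Ideal.map_isPrime_of_surjective Ideal.Quotient.mk_surjective (by rwa [Ideal.mk_ker])
  have h1 := hd ⟨_, hq⟩
  rw [Module.rankAtStalk_baseChange] at h1
  rw [← h1]
  refine Module.rankAtStalk_eq_of_le_of_finite_of_flat P (hpm.trans_eq ?_)
  exact (Ideal.comap_map_mk hIm).symm

/-! ### Lifting idempotent matrices and projective modules -/

section Idempotent

variable {R : Type u} [CommRing R] {I : Ideal R} {k : Type} [Fintype k] [DecidableEq k]

theorem Matrix.mapMatrix_mk_eq_zero_iff {J : Ideal R} {a : Matrix k k R} :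
    (Ideal.Quotient.mk J).mapMatrix a = 0 ↔ ∀ i j, a i j ∈ J := by
  simp [← Matrix.ext_iff, Ideal.Quotient.eq_zero_iff_mem]

theorem Matrix.mapMatrix_mk_mul_eq_zero {n : ℕ} (hn : 1 ≤ n) {a b : Matrix k k R}
    (ha : (Ideal.Quotient.mk (I ^ n)).mapMatrix a = 0)
    (hb : (Ideal.Quotient.mk (I ^ n)).mapMatrix b = 0) :
    (Ideal.Quotient.mk (I ^ (n + 1))).mapMatrix (a * b) = 0 := by
  rw [Matrix.mapMatrix_mk_eq_zero_iff] at *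
  intro i j
  rw [Matrix.mul_apply]
  refine Ideal.sum_mem _ fun l _ => ?_
  refine Ideal.pow_le_pow_right (show n + 1 ≤ n + n by omega) ?_
  rw [pow_add]
  exact Ideal.mul_mem_mul (ha i l) (hb l j)

theorem Matrix.exists_lift_isIdempotentElem_succ {n : ℕ} (hn : 1 ≤ n) (a : Matrix k k R)
    (ha : (Ideal.Quotient.mk (I ^ n)).mapMatrix (a - a * a) = 0) :
    ∃ b : Matrix k k R, (Ideal.Quotient.mk (I ^ n)).mapMatrix (b - a) = 0 ∧
      (Ideal.Quotient.mk (I ^ (n + 1))).mapMatrix (b - b * b) = 0 := by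
  -- Newton's step for `x^2 = x`: the new defect `b - b^2` is a multiple of the square of the old
  -- one.
  refine ⟨3 * a ^ 2 - 2 * a ^ 3, ?_, ?_⟩
  · have : 3 * a ^ 2 - 2 * a ^ 3 - a = (2 * a - 1) * (a - a * a) := by noncomm_ring
    rw [this, map_mul, ha, mul_zero]
  · have : 3 * a ^ 2 - 2 * a ^ 3 - (3 * a ^ 2 - 2 * a ^ 3) * (3 * a ^ 2 - 2 * a ^ 3) =
        ((a - a * a) * (a - a * a)) * ((3 - 2 * a) * (1 + 2 * a)) := by noncomm_ring
    rw [this, map_mul, Matrix.mapMatrix_mk_mul_eq_zero hn ha ha, zero_mul]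

/-- Idempotent matrices lift from `R ⧸ I` to an `I`-adically complete ring `R`. -/
theorem Matrix.exists_isIdempotentElem_lift [IsAdicComplete I R] (e : Matrix k k (R ⧸ I))
    (he : e * e = e) :
    ∃ E : Matrix k k R, E * E = E ∧ (Ideal.Quotient.mk I).mapMatrix E = e := by
  obtain ⟨a0, ha0⟩ : ∃ a0 : Matrix k k R, (Ideal.Quotient.mk I).mapMatrix a0 = e := by
    choose f hf using (Ideal.Quotient.mk_surjective (I := I))
    exact ⟨Matrix.of fun i j => f (e i j), by ext i j; simp [hf]⟩
  have h0 : (Ideal.Quotient.mk (I ^ (0 + 1))).mapMatrix (a0 - a0 * a0) = 0 := by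
    rw [Matrix.mapMatrix_mk_eq_zero_iff]
    rw [zero_add, pow_one, ← Matrix.mapMatrix_mk_eq_zero_iff, map_sub, map_mul, ha0, he, sub_self]
  -- The shift to `I ^ (n + 1)` lets the recursion start from an arbitrary lift, idempotent modulo
  -- `I`.
  let T (n : ℕ) := {a : Matrix k k R // (Ideal.Quotient.mk (I ^ (n + 1))).mapMatrix (a - a * a) = 0}
  choose next hnext1 hnext2 using fun (n : ℕ) (a : T n) =>
    Matrix.exists_lift_isIdempotentElem_succ (I := I) (Nat.le_add_left 1 n) a.1 a.2
  let s : ∀ n, T n := fun n =>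
    Nat.rec (motive := T) ⟨a0, h0⟩ (fun n a => ⟨next n a, hnext2 n a⟩) n
  have hs : ∀ n i j, (s (n + 1)).1 i j - (s n).1 i j ∈ I ^ (n + 1) := fun n =>
    Matrix.mapMatrix_mk_eq_zero_iff.1 (hnext1 n (s n))
  have hs' : ∀ n m, n ≤ m → ∀ i j, (s m).1 i j - (s n).1 i j ∈ I ^ (n + 1) := by
    intro n m hnm i j
    induction m, hnm using Nat.le_induction with
    | base => simp
    | succ m hm ih =>
      rw [← sub_add_sub_cancel _ ((s m).1 i j)]
      exact add_mem (Ideal.pow_le_pow_right (by omega) (hs m i j)) ih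
  have hlim : ∀ i j, ∃ L : R, ∀ n, (s n).1 i j ≡ L [SMOD (I ^ n • ⊤ : Ideal R)] := fun i j =>
    IsPrecomplete.prec (I := I) inferInstance fun {m n} hmn => by
      rw [SModEq.comm, SModEq.sub_mem, smul_eq_mul, Ideal.mul_top]
      exact Ideal.pow_le_pow_right m.le_succ (hs' m n hmn i j)
  choose L hL using hlim
  have hL' : ∀ n, (Ideal.Quotient.mk (I ^ n)).mapMatrix ((s n).1 - Matrix.of L) = 0 := fun n => by
    rw [Matrix.mapMatrix_mk_eq_zero_iff]
    intro i j
    have := hL i j n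
    rwa [SModEq.sub_mem, smul_eq_mul, Ideal.mul_top] at this
  refine ⟨Matrix.of L, ?_, ?_⟩
  · ext i j
    refine IsHausdorff.eq_iff_smodEq (I := I).2 fun n => ?_
    rw [SModEq.sub_mem, smul_eq_mul, Ideal.mul_top]
    refine Matrix.mapMatrix_mk_eq_zero_iff (a := Matrix.of L * Matrix.of L - Matrix.of L).1 ?_ i j
    have h1 := hL' n
    have h2 : (Ideal.Quotient.mk (I ^ n)).mapMatrix ((s n).1 - (s n).1 * (s n).1) = 0 :=
      Matrix.mapMatrix_mk_eq_zero_iff.2 fun i j => Ideal.pow_le_pow_right n.le_succ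
        (Matrix.mapMatrix_mk_eq_zero_iff.1 (s n).2 i j)
    rw [map_sub, sub_eq_zero] at h1
    rw [map_sub, map_mul, h1, sub_eq_zero] at h2
    rw [map_sub, map_mul, ← h2, sub_self]
  · rw [← ha0, eq_comm, ← sub_eq_zero, ← map_sub, Matrix.mapMatrix_mk_eq_zero_iff]
    intro i j
    have h1 := Matrix.mapMatrix_mk_eq_zero_iff.1 (hL' 1) i j
    have h2 := hs' 0 1 zero_le_one i j
    have h3 : (a0 - Matrix.of L) i j =
        ((s 1).1 - Matrix.of L) i j - ((s 1).1 i j - (s 0).1 i j) := by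
      change a0 i j - L i j = ((s 1).1 i j - L i j) - ((s 1).1 i j - a0 i j)
      ring
    rw [h3]
    exact sub_mem (by simpa using h1) (by simpa using h2)

end Idempotent

/-- Finite projective modules of constant rank lift from `R ⧸ I` to an `I`-adically complete
ring `R`. -/
theorem IsFiniteProjectiveOfConstantRankOverQuotient.exists_lift {R : Type u} [CommRing R]
    {I : Ideal R} [IsAdicComplete I R] {Q : Type u} [AddCommGroup Q] [Module R Q]
    (hQ : IsFiniteProjectiveOfConstantRankOverQuotient I Q) :
    ∃ (P : FinProjModule R) (π : P.carrier →ₗ[R] Q),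
      IsFiniteProjectiveOfConstantRank R P.carrier ∧ Function.Surjective π ∧
        LinearMap.ker π = I • ⊤ := by
  obtain ⟨h, h1⟩ := id hQ
  let _ := h.module
  have := h1.1
  have := h1.2.1
  obtain ⟨k, p, hp⟩ := Module.Finite.exists_fin' (R ⧸ I) Q
  obtain ⟨σ, hσ⟩ := Module.projective_lifting_property p LinearMap.id hp
  have hpσ : ∀ q, p (σ q) = q := fun q => LinearMap.congr_fun hσ q
  -- `σ ∘ p` is an idempotent of `(R ⧸ I)^k` with image isomorphic to `Q`; the lift of `Q` is the
  -- image of the lifted idempotent `E`.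
  obtain ⟨E, hE, hEe⟩ := Matrix.exists_isIdempotentElem_lift (I := I) (LinearMap.toMatrix' (σ ∘ₗ p))
    (by rw [← LinearMap.toMatrix'_mul]; congr 1; ext; simp [hpσ])
  let c : (Fin k → R) →ₗ[R] (Fin k → R ⧸ I) :=
    (Algebra.linearMap R (R ⧸ I)).compLeft (Fin k)
  have hc : Function.Surjective c := Ideal.Quotient.mk_surjective.comp_left
  have hcE : ∀ v, c (E.mulVec v) = σ (p (c v)) := fun v => by
    have : σ (p (c v)) = (LinearMap.toMatrix' (σ ∘ₗ p)).mulVec (c v) := by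
      rw [LinearMap.toMatrix'_mulVec]; rfl
    rw [this, ← hEe]
    ext i
    exact RingHom.map_mulVec (Ideal.Quotient.mk I) E v i
  let ε := Matrix.toLin' E
  have hε : ∀ v, ε (ε v) = ε v := fun v => by
    simp [ε, hE]
  have hproj : Module.Projective R (LinearMap.range ε) :=
    Module.Projective.of_split (LinearMap.range ε).subtype ε.rangeRestrict (by
      ext ⟨_, v, rfl⟩ : 1
      exact Subtype.ext (hε v))
  let π : LinearMap.range ε →ₗ[R] Q := p.restrictScalars R ∘ₗ c ∘ₗ (LinearMap.range ε).subtype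
  have hπ : Function.Surjective π := fun q => by
    obtain ⟨v, hv⟩ := hc (σ q)
    refine ⟨⟨ε v, v, rfl⟩, ?_⟩
    change p (c (E.mulVec v)) = q
    rw [hcE, hv, hpσ, hpσ]
  have hker : LinearMap.ker π = I • ⊤ := by
    refine le_antisymm ?_ (Submodule.smul_le.2 fun a ha x _ => ?_)
    · rintro ⟨_, v, rfl⟩ hx
      have h0 : c (ε v) = 0 := by
        have : p (c (ε v)) = 0 := hx
        rw [← hε]
        change c (E.mulVec (ε v)) = 0
        rw [hcE, this, map_zero]
      have h2 : ∀ i, ε v i ∈ I := fun i => Ideal.Quotient.eq_zero_iff_mem.1 (congrFun h0 i)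
      -- Applying `ε` once more places the element in `I` times the range of `ε`, not merely in `I`
      -- times the free module.
      have h3 : (⟨ε v, v, rfl⟩ : LinearMap.range ε) =
          ∑ i, ε v i • ε.rangeRestrict (Pi.single i 1) := by
        apply Subtype.ext
        rw [AddSubmonoidClass.coe_finsetSum]
        change ε v = ∑ i, ε v i • ε (Pi.single i 1)
        conv_lhs => rw [← hε, pi_eq_sum_univ' (ε v)]
        simp [map_sum]
      rw [h3]
      exact Submodule.sum_mem _ fun i _ => Submodule.smul_mem_smul (h2 i) trivial
    · rw [LinearMap.mem_ker, map_smul]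
      exact h (a := ⟨a, ha⟩)
  have := hQ.of_quotient (IsAdicComplete.le_jacobson_bot I) π hπ hker
  exact ⟨⟨LinearMap.range ε⟩, π, this, hπ, hker⟩

/-! ### Powers of a principal ideal and factorisation through surjections -/

theorem mem_span_singleton_pow_smul_top_iff {R : Type u} [CommRing R] (r : R) {M : Type u}
    [AddCommGroup M] [Module R M] (n : ℕ) (x : M) :
    x ∈ (Ideal.span {r} ^ n • ⊤ : Submodule R M) ↔ ∃ y, x = r ^ n • y := by
  rw [Ideal.span_singleton_pow, Submodule.ideal_span_singleton_smul]
  simp [Submodule.mem_smul_pointwise_iff_exists, eq_comm]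

theorem mem_span_singleton_smul_top_iff {R : Type u} [CommRing R] (r : R) {M : Type u}
    [AddCommGroup M] [Module R M] (x : M) :
    x ∈ (Ideal.span {r} • ⊤ : Submodule R M) ↔ ∃ y, x = r • y := by
  simpa using mem_span_singleton_pow_smul_top_iff r 1 x

theorem LinearMap.exists_factor_of_surjective {R M X Y : Type*} [CommRing R] [AddCommGroup M]
    [Module R M] [AddCommGroup X] [Module R X] [AddCommGroup Y] [Module R Y] (f : M →ₗ[R] X)
    (hf : Function.Surjective f) (g : M →ₗ[R] Y) (h : ∀ m, f m = 0 → g m = 0) :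
    ∃ φ : X →ₗ[R] Y, ∀ m, φ (f m) = g m :=
  ⟨(LinearMap.ker f).liftQ g h ∘ₗ (f.quotKerEquivOfSurjective hf).symm.toLinearMap, fun m => by
    have : (f.quotKerEquivOfSurjective hf).symm (f m) = Submodule.Quotient.mk m := by
      rw [LinearEquiv.symm_apply_eq]; rfl
    rw [LinearMap.comp_apply, LinearEquiv.coe_coe, this]
    exact Submodule.liftQ_apply _ g m⟩

theorem LinearMap.exists_equiv_of_surjective {R M X Y : Type*} [CommRing R] [AddCommGroup M]
    [Module R M] [AddCommGroup X] [Module R X] [AddCommGroup Y] [Module R Y] (f : M →ₗ[R] X)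
    (hf : Function.Surjective f) (g : M →ₗ[R] Y) (hg : Function.Surjective g)
    (h : ∀ m, f m = 0 ↔ g m = 0) : ∃ φ : X ≃ₗ[R] Y, ∀ m, φ (f m) = g m := by
  obtain ⟨φ, hφ⟩ := f.exists_factor_of_surjective hf g fun m => (h m).1
  obtain ⟨ψ, hψ⟩ := g.exists_factor_of_surjective hg f fun m => (h m).2
  refine ⟨LinearEquiv.ofLinearMap φ ψ ?_ ?_, hφ⟩
  · ext y
    obtain ⟨m, rfl⟩ := hg y
    simp [hφ, hψ]
  · ext y
    obtain ⟨m, rfl⟩ := hf y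
    simp [hφ, hψ]

theorem IsFiniteProjectiveOfConstantRankOverQuotient.of_exact {R : Type u} [CommRing R]
    {I : Ideal R} {K P Q : Type u} [AddCommGroup K] [Module R K] [AddCommGroup P] [Module R P]
    [AddCommGroup Q] [Module R Q] (hP : Module.IsTorsionBySet R P I)
    (hQ : IsFiniteProjectiveOfConstantRankOverQuotient I Q)
    (hK : IsFiniteProjectiveOfConstantRankOverQuotient I K) (j : K →ₗ[R] P) (g : P →ₗ[R] Q)
    (hj : Function.Injective j) (hg : Function.Surjective g)
    (hjg : LinearMap.range j = LinearMap.ker g) :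
    IsFiniteProjectiveOfConstantRankOverQuotient I P :=
  of_ker hP hQ g hg (hK.congr ((LinearEquiv.ofInjective j hj).trans (LinearEquiv.ofEq _ _ hjg)))

/-! ### The graded pieces of the `r`-adic filtration -/

section MuSubquotient

variable {R : Type u} [CommRing R] (r : R) (M : Type u) [AddCommGroup M] [Module R M]

/-- The map `M → r ^ n M / r ^ (n + 1) M` given by multiplication by `r ^ n`. -/
def MuSubquotient.of (n : ℕ) : M →ₗ[R] MuSubquotient r M n :=
  Submodule.mkQ _ ∘ₗ (LinearMap.lsmul R M (r ^ n)).rangeRestrict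

theorem MuSubquotient.of_surjective (n : ℕ) : Function.Surjective (MuSubquotient.of r M n) :=
  (Submodule.mkQ_surjective _).comp (LinearMap.surjective_rangeRestrict _)

variable {M} in
theorem MuSubquotient.of_eq_zero_iff (n : ℕ) (m : M) :
    MuSubquotient.of r M n m = 0 ↔ ∃ y : M, r ^ n • m = r ^ (n + 1) • y := by
  refine (Submodule.Quotient.mk_eq_zero _).trans ?_
  exact exists_congr fun y => eq_comm

variable {M}

/-- A quotient `X` of `M` with the same kernel as `M → r ^ n M / r ^ (n + 1) M` computes the
subquotient. -/
theorem muSubquotient_iff {n : ℕ} {X : Type u} [AddCommGroup X] [Module R X] (f : M →ₗ[R] X)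
    (hf : Function.Surjective f) (h : ∀ m, f m = 0 ↔ ∃ y : M, r ^ n • m = r ^ (n + 1) • y) :
    IsFiniteProjectiveOfConstantRankOverQuotient (Ideal.span {r}) (MuSubquotient r M n) ↔
      IsFiniteProjectiveOfConstantRankOverQuotient (Ideal.span {r}) X := by
  obtain ⟨e, -⟩ := LinearMap.exists_equiv_of_surjective _ (MuSubquotient.of_surjective r M n) f hf
    fun m => (MuSubquotient.of_eq_zero_iff r n m).trans (h m).symm
  exact ⟨fun H => H.congr e, fun H => H.congr e.symm⟩

/-- Multiplication by `r` on the graded module of the `r`-adic filtration. -/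
theorem MuSubquotient.exists_succ (n : ℕ) :
    ∃ f : MuSubquotient r M n →ₗ[R] MuSubquotient r M (n + 1), Function.Surjective f ∧
      ∀ m, f (MuSubquotient.of r M n m) = MuSubquotient.of r M (n + 1) m := by
  obtain ⟨f, hf⟩ := LinearMap.exists_factor_of_surjective _ (MuSubquotient.of_surjective r M n)
    (MuSubquotient.of r M (n + 1)) fun m hm => by
      obtain ⟨y, hy⟩ := (MuSubquotient.of_eq_zero_iff r n m).1 hm
      refine (MuSubquotient.of_eq_zero_iff r (n + 1) m).2 ⟨y, ?_⟩
      rw [pow_succ', mul_smul, hy, ← mul_smul, ← pow_succ']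
  refine ⟨f, fun x => ?_, hf⟩
  obtain ⟨m, rfl⟩ := MuSubquotient.of_surjective r M (n + 1) x
  exact ⟨_, hf m⟩

variable {r} {N : Type u} [AddCommGroup N] [Module R N]

theorem HasMuDevissage.congr (e : M ≃ₗ[R] N) (h : HasMuDevissage r M) : HasMuDevissage r N :=
  fun n => (muSubquotient_iff r (MuSubquotient.of r M n ∘ₗ e.symm.toLinearMap)
    ((MuSubquotient.of_surjective r M n).comp e.symm.surjective) fun m => by
      refine (MuSubquotient.of_eq_zero_iff r n _).trans ⟨?_, ?_⟩
      · rintro ⟨y, hy⟩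
        exact ⟨e y, e.symm.injective (by simpa using hy)⟩
      · rintro ⟨y, hy⟩
        exact ⟨e.symm y, by simpa using congrArg e.symm hy⟩).2 (h n)

theorem muSubquotient_prod_iff (n : ℕ) :
    IsFiniteProjectiveOfConstantRankOverQuotient (Ideal.span {r}) (MuSubquotient r (M × N) n) ↔
      IsFiniteProjectiveOfConstantRankOverQuotient (Ideal.span {r})
        (MuSubquotient r M n × MuSubquotient r N n) :=
  muSubquotient_iff r ((MuSubquotient.of r M n).prodMap (MuSubquotient.of r N n))
    (Prod.map_surjective.2 ⟨MuSubquotient.of_surjective r M n, MuSubquotient.of_surjective r N n⟩)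
    fun m => by
      rw [LinearMap.prodMap_apply, Prod.mk_eq_zero, MuSubquotient.of_eq_zero_iff,
        MuSubquotient.of_eq_zero_iff]
      simp only [Prod.exists, Prod.ext_iff, Prod.smul_fst, Prod.smul_snd]
      exact ⟨fun ⟨⟨a, ha⟩, ⟨b, hb⟩⟩ => ⟨a, b, ha, hb⟩, fun ⟨a, b, ha, hb⟩ => ⟨⟨a, ha⟩, ⟨b, hb⟩⟩⟩

theorem HasMuDevissage.prod (hM : HasMuDevissage r M) (hN : HasMuDevissage r N) :
    HasMuDevissage r (M × N) :=
  fun n => (muSubquotient_prod_iff n).2 ((hM n).prod (hN n))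

theorem HasMuDevissage.of_prod (hM : HasMuDevissage r M) (h : HasMuDevissage r (M × N)) :
    HasMuDevissage r N :=
  fun n => IsFiniteProjectiveOfConstantRankOverQuotient.of_prod (hM n)
    ((muSubquotient_prod_iff n).1 (h n))

theorem HasMuDevissage.pi {ι : Type} [Finite ι] {P : ι → Type u} [∀ i, AddCommGroup (P i)]
    [∀ i, Module R (P i)] (hP : ∀ i, HasMuDevissage r (P i)) : HasMuDevissage r (∀ i, P i) :=
  fun n => (muSubquotient_iff r (LinearMap.piMap fun i => MuSubquotient.of r (P i) n)
    (Function.Surjective.piMap fun i => MuSubquotient.of_surjective r (P i) n) fun m => by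
      rw [funext_iff]
      refine (forall_congr' fun i => MuSubquotient.of_eq_zero_iff r n (m i)).trans ?_
      simp only [funext_iff, Pi.smul_apply]
      exact Classical.skolem).2
    (IsFiniteProjectiveOfConstantRankOverQuotient.pi fun i => hP i n)

/-- Without torsion, multiplication by `r ^ n` identifies `M / r M` with every graded piece. -/
theorem HasMuDevissage.of_torsionFree (hM : IsFiniteProjectiveOfConstantRank R M)
    (h : ∀ x : M, r • x = 0 → x = 0) : HasMuDevissage r M := fun n => by
  have hn : ∀ n (x : M), r ^ n • x = 0 → x = 0 := fun n => by
    induction n with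
    | zero => simp
    | succ n ih => exact fun x hx => ih x (h _ (by rwa [← mul_smul, ← pow_succ']))
  refine (muSubquotient_iff r (Submodule.mkQ (Ideal.span {r} • ⊤)) (Submodule.mkQ_surjective _)
    fun m => ?_).2 (hM.quotient _ (Submodule.mkQ_surjective _) (Submodule.ker_mkQ _))
  rw [Submodule.mkQ_apply, Submodule.Quotient.mk_eq_zero, mem_span_singleton_smul_top_iff]
  refine exists_congr fun y => ⟨fun hy => by rw [hy, ← mul_smul, pow_succ], fun hy => ?_⟩
  rw [← sub_eq_zero]
  exact hn n _ (by rw [smul_sub, hy, ← mul_smul, pow_succ, sub_self])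

end MuSubquotient

/-! ### Adic separatedness and completeness -/

section Complete

variable {R : Type u} [CommRing R] (I : Ideal R) {M N : Type u} [AddCommGroup M] [Module R M]
  [AddCommGroup N] [Module R N]

theorem LinearMap.map_mem_smul_top (f : M →ₗ[R] N) {J : Ideal R} {x : M}
    (hx : x ∈ (J • ⊤ : Submodule R M)) : f x ∈ (J • ⊤ : Submodule R N) := by
  have := Submodule.mem_map_of_mem (f := f) hx
  rw [Submodule.map_smul''] at this
  exact Submodule.smul_mono le_rfl le_top this

/-- A projective module embeds in a free one, where separatedness is checked on coordinates. -/
theorem IsHausdorff.of_projective [IsHausdorff I R] [Module.Projective R M] : IsHausdorff I M where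
  haus' x hx := by
    obtain ⟨s, hs⟩ := Module.projective_lifting_property
      (Finsupp.linearCombination R (id : M → M)) LinearMap.id
      (Finsupp.linearCombination_id_surjective R M)
    have : s x = 0 := by
      ext m
      refine IsHausdorff.haus (I := I) inferInstance _ fun n => ?_
      have := hx n
      rw [SModEq.zero] at *
      exact (Finsupp.lapply m ∘ₗ s).map_mem_smul_top this
    rw [← LinearMap.id_apply (R := R) x, ← hs, LinearMap.comp_apply, this, map_zero]

theorem IsPrecomplete.pi_fin [IsPrecomplete I R] (k : ℕ) : IsPrecomplete I (Fin k → R) where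
  prec' f hf := by
    have hcoord : ∀ i, ∃ L : R, ∀ n, f n i ≡ L [SMOD (I ^ n • ⊤ : Ideal R)] := fun i =>
      IsPrecomplete.prec (I := I) inferInstance fun {m n} hmn => by
        have := hf hmn
        rw [SModEq.sub_mem] at *
        exact (LinearMap.proj (R := R) (φ := fun _ => R) i).map_mem_smul_top this
    choose L hL using hcoord
    refine ⟨L, fun n => ?_⟩
    rw [SModEq.sub_mem, pi_eq_sum_univ' (f n - L)]
    refine Submodule.sum_mem _ fun i _ => Submodule.smul_mem_smul ?_ trivial
    have := hL i n
    rwa [SModEq.sub_mem, smul_eq_mul, Ideal.mul_top] at this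

theorem IsPrecomplete.of_finite [IsPrecomplete I R] [Module.Finite R M] : IsPrecomplete I M := by
  obtain ⟨k, f, hf⟩ := Module.Finite.exists_fin' R M
  have := IsPrecomplete.pi_fin I k
  rw [← AdicCompletion.of_surjective_iff]
  intro y
  obtain ⟨x, rfl⟩ := AdicCompletion.map_surjective I hf y
  obtain ⟨x, rfl⟩ := AdicCompletion.of_surjective I (Fin k → R) x
  exact ⟨f x, (AdicCompletion.map_of ..).symm⟩

theorem IsHausdorff.prod [IsHausdorff I M] [IsHausdorff I N] : IsHausdorff I (M × N) where
  haus' x hx := by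
    simp only [SModEq.zero] at hx
    refine Prod.ext (IsHausdorff.haus (I := I) inferInstance _ fun n => ?_)
      (IsHausdorff.haus (I := I) inferInstance _ fun n => ?_) <;> rw [SModEq.zero]
    · exact (LinearMap.fst R M N).map_mem_smul_top (hx n)
    · exact (LinearMap.snd R M N).map_mem_smul_top (hx n)

theorem IsHausdorff.congr [IsHausdorff I M] (e : M ≃ₗ[R] N) : IsHausdorff I N where
  haus' x hx := by
    simp only [SModEq.zero] at hx
    refine e.symm.injective ((IsHausdorff.haus (I := I) inferInstance _ fun n => ?_).trans
      (map_zero e.symm).symm)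
    rw [SModEq.zero]
    exact e.symm.toLinearMap.map_mem_smul_top (hx n)

theorem IsHausdorff.of_isTorsionBy {r : R} {n : ℕ} (h : Module.IsTorsionBy R M (r ^ n)) :
    IsHausdorff (Ideal.span {r}) M where
  haus' x hx := by
    obtain ⟨y, rfl⟩ := (mem_span_singleton_pow_smul_top_iff r n x).1 (SModEq.zero.1 (hx n))
    exact @h y

/-- A separated module over an `I`-adically complete ring is finite as soon as it is finite
modulo `I`. -/
theorem Module.Finite.of_isHausdorff [IsPrecomplete I R] [IsHausdorff I M] {X : Type u}
    [AddCommGroup X] [Module R X] [Module.Finite R X] (f : M →ₗ[R] X)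
    (hf : Function.Surjective f) (h : LinearMap.ker f ≤ I • ⊤) : Module.Finite R M := by
  obtain ⟨k, p, hp⟩ := Module.Finite.exists_fin' R X
  obtain ⟨φ, hφ⟩ := Module.projective_lifting_property f p hf
  have := IsPrecomplete.pi_fin I k
  -- Successive approximation: `R^k` is complete and `M` separated, so surjectivity of `φ` need only
  -- be checked modulo `I`.
  refine Module.Finite.of_surjective φ (surjective_of_mkQ_comp_surjective (I := I) fun y => ?_)
  obtain ⟨m, rfl⟩ := Submodule.mkQ_surjective _ y
  obtain ⟨x, hx⟩ := hp (f m)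
  refine ⟨x, (Submodule.Quotient.eq _).2 (h ?_)⟩
  rw [LinearMap.mem_ker, map_sub, ← hx, ← hφ]
  exact sub_self _

end Complete

/-! ### Torsion-free modules that are projective modulo `r` -/

section TorsionFree

variable {R : Type u} [CommRing R] {r : R} {M : Type u} [AddCommGroup M] [Module R M]

theorem Module.Projective.eq_zero_of_smul_eq_zero (hr : Submodule.torsionBy R R r = ⊥)
    [Module.Projective R M] (x : M) (hx : r • x = 0) : x = 0 := by
  obtain ⟨s, hs⟩ := Module.projective_lifting_property
    (Finsupp.linearCombination R (id : M → M)) LinearMap.id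
    (Finsupp.linearCombination_id_surjective R M)
  have : s x = 0 := by
    ext m
    have h1 : r • s x m = 0 := by
      rw [← Finsupp.smul_apply, ← map_smul, hx, map_zero, Finsupp.zero_apply]
    exact (Submodule.mem_bot R).1 (hr ▸ (Submodule.mem_torsionBy_iff r _).2 h1)
  rw [← LinearMap.id_apply (R := R) x, ← hs, LinearMap.comp_apply, this, map_zero]

/-- A finite torsion-free module which is finite projective of constant rank modulo `r` is finite
projective of constant rank. -/
theorem IsFiniteProjectiveOfConstantRank.of_torsionFree [IsAdicComplete (Ideal.span {r}) R]
    [Module.Finite R M] (h : ∀ x : M, r • x = 0 → x = 0) {X : Type u} [AddCommGroup X] [Module R X]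
    (hX : IsFiniteProjectiveOfConstantRankOverQuotient (Ideal.span {r}) X) (f : M →ₗ[R] X)
    (hf : Function.Surjective f) (hker : ∀ x, f x = 0 ↔ ∃ y, x = r • y) :
    IsFiniteProjectiveOfConstantRank R M := by
  obtain ⟨P, π, hP, hπ, hπker⟩ := hX.exists_lift
  obtain ⟨φ, hφ⟩ := Module.projective_lifting_property f π hf
  have hφ' : ∀ x, f (φ x) = π x := fun x => LinearMap.congr_fun hφ x
  have hsurj : Function.Surjective φ := by
    rw [← LinearMap.range_eq_top, eq_top_iff]
    refine Submodule.le_of_le_smul_of_le_jacobson_bot (I := Ideal.span {r}) Module.Finite.fg_top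
      (IsAdicComplete.le_jacobson_bot _) fun x _ => ?_
    obtain ⟨p, hp⟩ := hπ (f x)
    rw [← add_sub_cancel (φ p) x]
    refine Submodule.add_mem_sup ⟨p, rfl⟩ ((mem_span_singleton_smul_top_iff r _).2 ((hker _).1 ?_))
    rw [map_sub, hφ', hp, sub_self]
  have hinj : Function.Injective φ := by
    have := IsHausdorff.of_projective (M := P.carrier) (Ideal.span {r})
    -- The kernel of `φ` lies in `ker π = r P`, and torsion-freeness of `M` allows division by `r`
    -- inside the kernel. Iterating, it lies in every `r ^ n P`.
    have key : ∀ n x, φ x = 0 → ∃ y, x = r ^ n • y ∧ φ y = 0 := fun n => by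
      induction n with
      | zero => exact fun x hx => ⟨x, by simp, hx⟩
      | succ n ih =>
        intro x hx
        obtain ⟨y, rfl, hy⟩ := ih x hx
        have h1 : y ∈ LinearMap.ker π := by rw [LinearMap.mem_ker, ← hφ', hy, map_zero]
        rw [hπker] at h1
        obtain ⟨z, rfl⟩ := (mem_span_singleton_smul_top_iff r y).1 h1
        exact ⟨z, by rw [pow_succ, mul_smul], h _ (by rw [← map_smul, hy])⟩
    refine (injective_iff_map_eq_zero φ).2 fun x hx =>
      IsHausdorff.haus (I := Ideal.span {r}) inferInstance x fun n => ?_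
    obtain ⟨y, hy, -⟩ := key n x hx
    exact SModEq.zero.2 ((mem_span_singleton_pow_smul_top_iff r n x).2 ⟨y, hy⟩)
  exact hP.congr (LinearEquiv.ofBijective φ ⟨hinj, hsurj⟩)

end TorsionFree

/-! ### Bounded torsion, splitting off the torsion, and the `τ`-dévissage -/

section Torsion

variable {R : Type u} [CommRing R] {r : R} {M : Type u} [AddCommGroup M] [Module R M]

/-- Once the torsion filtration fails to grow at one step, it never grows again. The case `N = 0` is
torsion-freeness. -/
theorem pow_smul_eq_zero_of_le {N n : ℕ} (hNn : N ≤ n)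
    (hN : ∀ m : M, r ^ (N + 1) • m = 0 → r ^ N • m = 0) (m : M) (h : r ^ n • m = 0) :
    r ^ N • m = 0 := by
  induction n, hNn using Nat.le_induction with
  | base => exact h
  | succ n hn ih =>
    refine ih ?_
    rw [← Nat.add_sub_cancel' hn, pow_add, mul_smul]
    refine hN _ ?_
    rwa [← mul_smul, ← pow_add, show N + 1 + (n - N) = n + 1 by omega]

theorem hasBoundedTorsion_iff :
    HasBoundedTorsion r M ↔ ∃ N, ∀ m : M, r ^ (N + 1) • m = 0 → r ^ N • m = 0 := by
  refine ⟨fun ⟨N, hN⟩ => ⟨N, fun m hm => hN (N + 1) hm⟩, fun ⟨N, hN⟩ => ⟨N, fun n m hm => ?_⟩⟩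
  rw [Submodule.mem_torsionBy_iff] at *
  exact pow_smul_eq_zero_of_le (Nat.le_add_right N n) hN m
    (by rw [pow_add, mul_smul, hm, smul_zero])

/-- Finite projective `(r, μ)`-dévissage of a separated module bounds the torsion. -/
theorem HasMuDevissage.hasBoundedTorsion [IsHausdorff (Ideal.span {r}) M]
    (hM : HasMuDevissage r M) : HasBoundedTorsion r M := by
  choose f hf hfr using fun n => MuSubquotient.exists_succ r (M := M) n
  obtain ⟨N, hN⟩ :=
    IsFiniteProjectiveOfConstantRankOverQuotient.eventually_injective hM f hf
  have hdiv : ∀ n, N ≤ n → ∀ m y : M, r ^ (n + 1) • m = r ^ (n + 2) • y →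
      ∃ y : M, r ^ n • m = r ^ (n + 1) • y := fun n hn m y h => by
    refine (MuSubquotient.of_eq_zero_iff r n m).1 (hN n hn ?_)
    rw [hfr, map_zero, MuSubquotient.of_eq_zero_iff]
    exact ⟨y, h⟩
  refine hasBoundedTorsion_iff.2 ⟨N, fun m hm => ?_⟩
  -- Since `r ^ (N + k + 1)` kills `y`, injectivity of the next graded map makes `r ^ (N + k) • y`
  -- divisible by one more power of `r`.
  have key : ∀ k, ∃ y : M, r ^ N • m = r ^ (N + k) • y ∧ r ^ (N + k + 1) • y = 0 := fun k => by
    induction k with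
    | zero => exact ⟨m, rfl, hm⟩
    | succ k ih =>
      obtain ⟨y, hy, hy0⟩ := ih
      obtain ⟨z, hz⟩ := hdiv (N + k) (Nat.le_add_right _ _) y 0 (by rw [hy0, smul_zero])
      refine ⟨z, hy.trans hz, ?_⟩
      rw [← add_assoc, pow_succ', mul_smul, ← hz, ← mul_smul, ← pow_succ', hy0]
  refine IsHausdorff.haus (I := Ideal.span {r}) inferInstance _ fun k => ?_
  obtain ⟨y, hy, -⟩ := key k
  refine SModEq.zero.2 ((mem_span_singleton_pow_smul_top_iff r k _).2 ⟨r ^ N • y, ?_⟩)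
  rw [hy, ← mul_smul, ← pow_add, add_comm]

theorem HasMuDevissage.finite [IsPrecomplete (Ideal.span {r}) R] [IsHausdorff (Ideal.span {r}) M]
    (hM : HasMuDevissage r M) : Module.Finite R M := by
  have := (hM 0).finite
  refine Module.Finite.of_isHausdorff (Ideal.span {r}) _ (MuSubquotient.of_surjective r M 0)
    fun x hx => ?_
  simpa [mem_span_singleton_smul_top_iff] using (MuSubquotient.of_eq_zero_iff r 0 x).1 hx

theorem HasMuDevissage.hasTorsionDecomposition [IsAdicComplete (Ideal.span {r}) R]
    [Module.Finite R M] (hM : HasMuDevissage r M) (hb : HasBoundedTorsion r M) :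
    HasTorsionDecomposition r M := by
  obtain ⟨N, hN⟩ := hasBoundedTorsion_iff.1 hb
  -- Already `r ^ N M` is torsion-free; the exponent `N + 1` meets the requirement that the exponent
  -- be at least one.
  let g : M →ₗ[R] powMul r M (N + 1) := (LinearMap.lsmul R M (r ^ (N + 1))).rangeRestrict
  have hg : Function.Surjective g := LinearMap.surjective_rangeRestrict _
  have hfin : Module.Finite R (powMul r M (N + 1)) := Module.Finite.of_surjective g hg
  have htf : ∀ x : powMul r M (N + 1), r • x = 0 → x = 0 := by
    rintro ⟨_, m, rfl⟩ hx
    have h1 : r • r ^ (N + 1) • m = 0 := congrArg Subtype.val hx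
    refine Subtype.ext ?_
    change r ^ (N + 1) • m = 0
    rw [pow_succ', mul_smul, pow_smul_eq_zero_of_le (n := N + 2) (by omega) hN m
      (by rw [pow_succ', mul_smul, h1]), smul_zero]
  have hinf : IsFiniteProjectiveOfConstantRank R (powMul r M (N + 1)) := by
    refine IsFiniteProjectiveOfConstantRank.of_torsionFree htf (hM (N + 1))
      (Submodule.mkQ _) (Submodule.mkQ_surjective _) fun x => ?_
    refine (Submodule.Quotient.mk_eq_zero _).trans ⟨?_, ?_⟩
    · rintro ⟨y, hy⟩
      refine ⟨⟨r ^ (N + 1) • y, y, rfl⟩, Subtype.ext ?_⟩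
      change x.1 = r • r ^ (N + 1) • y
      rw [← mul_smul, ← pow_succ']
      exact hy.symm
    · rintro ⟨⟨_, y, rfl⟩, rfl⟩
      refine ⟨y, ?_⟩
      change r ^ (N + 1 + 1) • y = r • r ^ (N + 1) • y
      rw [← mul_smul, ← pow_succ']
  have := hinf.2.1
  obtain ⟨s, hs⟩ := Module.projective_lifting_property g LinearMap.id hg
  let e := lequivProdOfRightSplitExact (j := (LinearMap.ker g).subtype) (g := g) (f := s)
    Subtype.val_injective (by simp) hs
  let e' := e.symm.trans (LinearEquiv.prodComm R _ _)
  exact ⟨N + 1, by omega, powMul r M (N + 1), inferInstance, inferInstance, LinearMap.ker g,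
    inferInstance, inferInstance, hinf,
    fun {x} => Subtype.ext ((Subtype.ext_iff (a1 := g x) (a2 := 0)).1 x.2),
    HasMuDevissage.of_prod (HasMuDevissage.of_torsionFree hinf htf) (hM.congr e'), ⟨e'⟩⟩

/-- Multiplication by `r ^ n` induces the isomorphism; it turns the `τ`-pieces into a descending
filtration of `M[r]`. -/
theorem exists_tauSubquotient_equiv (n : ℕ) :
    Nonempty (TauSubquotient r M n ≃ₗ[R] ↥(Submodule.torsionBy R M r ⊓ powMul r M n)) := by
  let g : Submodule.torsionBy R M (r ^ (n + 1)) →ₗ[R] ↥(Submodule.torsionBy R M r ⊓ powMul r M n) :=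
    (LinearMap.lsmul R M (r ^ n)).restrict fun m hm => by
      refine ⟨?_, m, rfl⟩
      rw [Submodule.mem_torsionBy_iff] at *
      change r • r ^ n • m = 0
      rwa [← mul_smul, ← pow_succ']
  obtain ⟨e, -⟩ := LinearMap.exists_equiv_of_surjective (Submodule.mkQ _)
    (Submodule.mkQ_surjective ((Submodule.torsionBy R M (r ^ n)).submoduleOf
      (Submodule.torsionBy R M (r ^ (n + 1))))) g
    (by
      rintro ⟨_, hx, m, rfl⟩
      refine ⟨⟨m, ?_⟩, rfl⟩
      rw [Submodule.mem_torsionBy_iff] at *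
      rw [pow_succ', mul_smul]
      exact hx)
    fun m => (Submodule.Quotient.mk_eq_zero _).trans
      (Subtype.ext_iff (a1 := g m) (a2 := 0)).symm
  exact ⟨e⟩

theorem HasMuDevissage.hasTauDevissage (hM : HasMuDevissage r M) (hb : HasBoundedTorsion r M) :
    HasTauDevissage r M := by
  obtain ⟨N, hN⟩ := hasBoundedTorsion_iff.1 hb
  suffices h : ∀ n, IsFiniteProjectiveOfConstantRankOverQuotient (Ideal.span {r})
      ↥(Submodule.torsionBy R M r ⊓ powMul r M n) by
    intro n
    obtain ⟨e⟩ := exists_tauSubquotient_equiv (r := r) (M := M) n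
    exact (h n).congr e.symm
  have hbig : ∀ n, N ≤ n → IsFiniteProjectiveOfConstantRankOverQuotient (Ideal.span {r})
      ↥(Submodule.torsionBy R M r ⊓ powMul r M n) := fun n hn => by
    have : Submodule.torsionBy R M r ⊓ powMul r M n = ⊥ := by
      refine (Submodule.eq_bot_iff _).2 ?_
      rintro _ ⟨hx, m, rfl⟩
      have h1 : r ^ (n + 1) • m = 0 := by
        rw [pow_succ', mul_smul]; exact hx
      change r ^ n • m = 0
      rw [← Nat.sub_add_cancel hn, pow_add, mul_smul,
        pow_smul_eq_zero_of_le (hn.trans n.le_succ) hN m h1, smul_zero]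
    rw [this]
    exact IsFiniteProjectiveOfConstantRankOverQuotient.of_subsingleton
  -- The sequence `0 → M[r] ∩ r^(n+1) M → M[r] ∩ r^n M → ker (gr^n → gr^(n+1)) → 0` is exact, which
  -- allows descending induction from the vanishing range `N ≤ n`.
  have hstep : ∀ n, IsFiniteProjectiveOfConstantRankOverQuotient (Ideal.span {r})
        ↥(Submodule.torsionBy R M r ⊓ powMul r M (n + 1)) →
      IsFiniteProjectiveOfConstantRankOverQuotient (Ideal.span {r})
        ↥(Submodule.torsionBy R M r ⊓ powMul r M n) := fun n hn => by
    obtain ⟨f, hf, hfr⟩ := MuSubquotient.exists_succ r (M := M) n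
    have hle : powMul r M (n + 1) ≤ powMul r M n := by
      rintro _ ⟨m, rfl⟩
      exact ⟨r • m, (mul_smul _ _ _).symm.trans (congrArg (· • m) (pow_succ r n).symm)⟩
    let γ : ↥(Submodule.torsionBy R M r ⊓ powMul r M n) →ₗ[R] MuSubquotient r M n :=
      Submodule.mkQ _ ∘ₗ Submodule.inclusion inf_le_right
    have hγ : ∀ x, f (γ x) = 0 := by
      rintro ⟨_, hx, m, rfl⟩
      change f (MuSubquotient.of r M n m) = 0
      rw [hfr, MuSubquotient.of_eq_zero_iff]
      refine ⟨0, ?_⟩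
      rw [smul_zero, pow_succ', mul_smul]
      exact hx
    refine IsFiniteProjectiveOfConstantRankOverQuotient.of_exact ?_ ((hM n).ker (hM (n + 1)) f hf)
      hn (Submodule.inclusion (inf_le_inf_left _ hle)) (γ.codRestrict _ hγ)
      (Submodule.inclusion_injective _) ?_ ?_
    · rw [Module.isTorsionBySet_span_singleton_iff]
      exact fun x => Subtype.ext x.2.1
    · rintro ⟨x, hx⟩
      obtain ⟨m, rfl⟩ := MuSubquotient.of_surjective r M n x
      rw [LinearMap.mem_ker, hfr, MuSubquotient.of_eq_zero_iff] at hx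
      obtain ⟨y, hy⟩ := hx
      refine ⟨⟨r ^ n • (m - r • y), ?_, _, rfl⟩, Subtype.ext ?_⟩
      · rw [SetLike.mem_coe, Submodule.mem_torsionBy_iff, ← mul_smul, ← pow_succ', smul_sub, hy,
          ← mul_smul, ← pow_succ, sub_self]
      · change MuSubquotient.of r M n (m - r • y) = MuSubquotient.of r M n m
        rw [map_sub, sub_eq_self, MuSubquotient.of_eq_zero_iff]
        exact ⟨y, by rw [← mul_smul, ← pow_succ]⟩
    · ext x
      rw [LinearMap.mem_ker, LinearMap.mem_range, Subtype.ext_iff]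
      refine Iff.trans ?_ (Submodule.Quotient.mk_eq_zero _).symm
      constructor
      · rintro ⟨y, rfl⟩
        exact y.2.2
      · exact fun hx => ⟨⟨x, x.2.1, hx⟩, rfl⟩
  intro n
  rcases le_total N n with h | h
  · exact hbig n h
  · exact Nat.decreasingInduction (fun n _ ih => hstep n ih) (hbig N le_rfl) h

end Torsion

/-! ### Generators of torsion modules -/

section Decomposition

variable {R : Type u} [CommRing R] {r : R}

theorem hasMuDevissage_range_lsmul {M : Type u} [AddCommGroup M] [Module R M]
    (hM : HasMuDevissage r M) : HasMuDevissage r (LinearMap.range (LinearMap.lsmul R M r)) := by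
  intro n
  refine (muSubquotient_iff r
    (MuSubquotient.of r _ n ∘ₗ (LinearMap.lsmul R M r).rangeRestrict)
    ((MuSubquotient.of_surjective r _ n).comp (LinearMap.surjective_rangeRestrict _))
    fun m => ?_).1 (hM (n + 1))
  refine (MuSubquotient.of_eq_zero_iff r n _).trans ⟨?_, ?_⟩
  · rintro ⟨⟨_, y, rfl⟩, hy⟩
    have h : r ^ n • r • m = r ^ (n + 1) • r • y := congrArg Subtype.val hy
    exact ⟨y, by rw [pow_succ, mul_smul, h, ← mul_smul, ← pow_succ]⟩
  · rintro ⟨y, hy⟩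
    refine ⟨⟨r • y, y, rfl⟩, Subtype.ext ?_⟩
    change r ^ n • r • m = r ^ (n + 1) • r • y
    rw [← mul_smul, ← pow_succ, hy, ← mul_smul, ← pow_succ]

/-- The kernel `K` of `M / r M → r M / r ^ 2 M` is covered by a finite projective module `P` mapping
to `M[r]`. -/
theorem HasMuDevissage.exists_torsion_generators [IsAdicComplete (Ideal.span {r}) R]
    {M : Type u} [AddCommGroup M] [Module R M] (hM : HasMuDevissage r M) :
    ∃ (P : FinProjModule R) (φ : P.carrier →ₗ[R] M),
      IsFiniteProjectiveOfConstantRank R P.carrier ∧ (∀ p, r • φ p = 0) ∧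
      (∀ p y, φ p = r • y → ∃ q, p = r • q) ∧
      ∀ m, r • m = 0 → ∃ p y, m = φ p + r • y := by
  obtain ⟨f, hf, hfr⟩ := MuSubquotient.exists_succ r (M := M) 0
  obtain ⟨P, π, hP, hπ, hπker⟩ := ((hM 0).ker (hM 1) f hf).exists_lift
  let τ : Submodule.torsionBy R M r →ₗ[R] LinearMap.ker f :=
    (MuSubquotient.of r M 0 ∘ₗ Submodule.subtype _).codRestrict _ fun t => by
      rw [LinearMap.mem_ker]
      change f (MuSubquotient.of r M 0 t) = 0
      rw [hfr, MuSubquotient.of_eq_zero_iff]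
      refine ⟨0, ?_⟩
      rw [smul_zero, zero_add, pow_one]
      exact t.2
  -- If `r • m = r ^ 2 • y`, then `m - r • y` is an `r`-torsion element with the same class as `m`.
  have hτ : Function.Surjective τ := by
    rintro ⟨x, hx⟩
    obtain ⟨m, rfl⟩ := MuSubquotient.of_surjective r M 0 x
    rw [LinearMap.mem_ker, hfr, MuSubquotient.of_eq_zero_iff] at hx
    obtain ⟨y, hy⟩ := hx
    refine ⟨⟨m - r • y, ?_⟩, Subtype.ext ?_⟩
    · rw [Submodule.mem_torsionBy_iff, smul_sub, ← mul_smul, ← pow_two]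
      simpa [sub_eq_zero] using hy
    · change MuSubquotient.of r M 0 (m - r • y) = MuSubquotient.of r M 0 m
      rw [map_sub, sub_eq_self, MuSubquotient.of_eq_zero_iff]
      exact ⟨y, by simp⟩
  obtain ⟨σ, hσ⟩ := Module.projective_lifting_property τ π hτ
  have hσ' : ∀ p, MuSubquotient.of r M 0 (σ p).1 = (π p).1 := fun p =>
    congrArg Subtype.val (LinearMap.congr_fun hσ p)
  refine ⟨P, (Submodule.torsionBy R M r).subtype ∘ₗ σ, hP, fun p => (σ p).2, fun p y hp => ?_,
    fun m hm => ?_⟩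
  · have h1 : π p = 0 := by
      refine Subtype.ext ((hσ' p).symm.trans ?_)
      refine (MuSubquotient.of_eq_zero_iff r 0 _).2 ⟨y, ?_⟩
      simpa using hp
    rw [← LinearMap.mem_ker, hπker] at h1
    exact (mem_span_singleton_smul_top_iff r p).1 h1
  · obtain ⟨p, hp⟩ := hπ (τ ⟨m, hm⟩)
    have h1 : MuSubquotient.of r M 0 (m - (σ p).1) = 0 := by
      rw [map_sub, hσ', hp]
      exact sub_self _
    obtain ⟨y, hy⟩ := (MuSubquotient.of_eq_zero_iff r 0 _).1 h1
    refine ⟨p, y, ?_⟩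
    simpa [sub_eq_iff_eq_add'] using hy

/-- Induction through `rM`: its generators `φ n` are lifted along `r : M → rM` to `ψ n`, whose
exponents grow by one, and `P0` supplies the new summand of exponent one. Index `n` carries exponent
`n + 1`; only indices below `N` matter. -/
theorem exists_generators_of_pow_smul_eq_zero [IsAdicComplete (Ideal.span {r}) R] (N : ℕ) :
    ∀ (M : Type u) [AddCommGroup M] [Module R M], (∀ m : M, r ^ N • m = 0) → HasMuDevissage r M →
      ∃ (P : ℕ → FinProjModule R) (φ : ∀ n, (P n).carrier →ₗ[R] M),
        (∀ n, IsFiniteProjectiveOfConstantRank R (P n).carrier) ∧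
        (∀ m, ∃ x : ∀ n, (P n).carrier, ∑ n ∈ Finset.range N, φ n (x n) = m) ∧
        ∀ x : ∀ n, (P n).carrier, ∑ n ∈ Finset.range N, φ n (x n) = 0 ↔
          ∀ n < N, ∃ y, x n = r ^ (n + 1) • y := by
  induction N with
  | zero =>
    intro M _ _ h _
    have h' : ∀ m : M, m = 0 := fun m => by simpa using h m
    exact ⟨fun _ => ⟨PUnit⟩, fun _ => 0, fun _ => .of_subsingleton,
      fun m => ⟨fun _ => 0, (h' _).trans (h' _).symm⟩, fun x => by simp⟩
  | succ N ih =>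
    intro M _ _ h hM
    obtain ⟨P, φ, hP, hsurj, hker⟩ := ih (LinearMap.range (LinearMap.lsmul R M r))
      (by
        rintro ⟨_, m, rfl⟩
        refine Subtype.ext ?_
        change r ^ N • r • m = 0
        rw [← mul_smul, ← pow_succ, h])
      (hasMuDevissage_range_lsmul hM)
    obtain ⟨P0, φ0, hP0, hφ0, hφ0r, hφ0M⟩ := hM.exists_torsion_generators
    choose ψ hψ using fun n => Module.projective_lifting_property
      (LinearMap.lsmul R M r).rangeRestrict (φ n) (LinearMap.surjective_rangeRestrict _)
    have hψ' : ∀ n p, r • ψ n p = (φ n p).1 := fun n p =>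
      congrArg Subtype.val (LinearMap.congr_fun (hψ n) p)
    have hsum : ∀ x : ∀ n, (P n).carrier, r • ∑ n ∈ Finset.range N, ψ n (x n) =
        (∑ n ∈ Finset.range N, φ n (x n) : LinearMap.range (LinearMap.lsmul R M r)).1 := fun x => by
      rw [Finset.smul_sum, AddSubmonoidClass.coe_finsetSum]
      exact Finset.sum_congr rfl fun n _ => hψ' n _
    refine ⟨fun n => Nat.casesOn n P0 P, fun n => Nat.casesOn n φ0 ψ, fun n => Nat.casesOn n hP0 hP,
      fun m => ?_, fun x => ?_⟩
    · obtain ⟨x, hx⟩ := hsurj ⟨r • m, m, rfl⟩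
      have hx' := (hsum x).trans (congrArg Subtype.val hx)
      -- The difference is `r`-torsion, hence `φ0 p + r • y`. As `r • y` lies in `rM`, it is `r`
      -- times a combination of the `ψ n`.
      obtain ⟨p, y, hy⟩ := hφ0M (m - ∑ n ∈ Finset.range N, ψ n (x n))
        (by rw [smul_sub, hx', sub_self])
      obtain ⟨z, hz⟩ := hsurj ⟨r • y, y, rfl⟩
      have hz' := (hsum z).trans (congrArg Subtype.val hz)
      refine ⟨fun n => Nat.casesOn n p fun n => x n + r • z n, ?_⟩
      rw [Finset.sum_range_succ']
      change ∑ n ∈ Finset.range N, ψ n (x n + r • z n) + φ0 p = m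
      simp only [map_add, map_smul, Finset.sum_add_distrib, ← Finset.smul_sum]
      rw [hz', sub_eq_iff_eq_add] at *
      rw [hy]
      abel
    · rw [Finset.sum_range_succ']
      change ∑ n ∈ Finset.range N, ψ n (x (n + 1)) + φ0 (x 0) = 0 ↔ _
      have hval : ∀ y : ∀ n, (P n).carrier, (∀ n < N, x (n + 1) = r ^ (n + 1) • y n) →
          ∑ n ∈ Finset.range N, ψ n (x (n + 1)) =
            (∑ n ∈ Finset.range N, φ n (r ^ n • y n) :
              LinearMap.range (LinearMap.lsmul R M r)).1 := fun y hy => by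
        rw [AddSubmonoidClass.coe_finsetSum]
        refine Finset.sum_congr rfl fun n hn => ?_
        rw [hy n (Finset.mem_range.1 hn), pow_succ', mul_smul, map_smul, hψ']
      constructor
      -- The relations of `rM` are used twice. Multiplying by `r` removes `φ0` and gives `x (n + 1)
      -- = r ^ (n + 1) • y n`; the `ψ`-sum then lies in `rM`, so `x 0` is divisible by `r` and `φ0
      -- (x 0) = 0`. What remains is a relation in `rM` among the `r ^ n • y n`, yielding the last
      -- factor of `r`.
      · intro hx
        have h1 : ∑ n ∈ Finset.range N, φ n (x (n + 1)) = 0 := by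
          refine Subtype.ext ((hsum fun n => x (n + 1)).symm.trans ?_)
          rw [eq_neg_of_add_eq_zero_left hx, smul_neg, hφ0, neg_zero]
          rfl
        have h2 : ∀ n, ∃ y : (P n).carrier, n < N → x (n + 1) = r ^ (n + 1) • y := fun n => by
          by_cases hn : n < N
          · obtain ⟨y, hy⟩ := (hker fun n => x (n + 1)).1 h1 n hn
            exact ⟨y, fun _ => hy⟩
          · exact ⟨0, fun h => absurd h hn⟩
        choose y hy using h2
        have h3 := hval y hy
        obtain ⟨w, hw⟩ := (∑ n ∈ Finset.range N, φ n (r ^ n • y n) :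
          LinearMap.range (LinearMap.lsmul R M r)).2
        obtain ⟨q, hq⟩ := hφ0r (x 0) (-w) (by
          rw [eq_neg_of_add_eq_zero_right hx, h3, ← hw, smul_neg]; rfl)
        have h4 : φ0 (x 0) = 0 := by
          have : φ0 (x 0) = φ0 (r • q) := congrArg φ0 hq
          rw [this, map_smul, hφ0]
        rw [h4, add_zero, h3] at hx
        have h5 := (hker fun n => r ^ n • y n).1 (Subtype.ext hx)
        intro n hn
        cases n with
        | zero => exact ⟨q, by simpa using hq⟩
        | succ n =>
          obtain ⟨z, hz⟩ := h5 n (by omega)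
          refine ⟨z, (hy n (by omega)).trans ?_⟩
          change _ = (r ^ (n + 1 + 1) • z : (P n).carrier)
          rw [pow_succ', mul_smul, hz, ← mul_smul, ← pow_succ']
      · intro hx
        obtain ⟨q, hq⟩ := hx 0 N.succ_pos
        have h4 : φ0 (x 0) = 0 := by
          have : φ0 (x 0) = φ0 (r ^ (0 + 1) • q) := congrArg φ0 hq
          rw [this, zero_add, pow_one, map_smul, hφ0]
        have h2 : ∀ n, ∃ y : (P n).carrier, n < N → x (n + 1) = r ^ (n + 1 + 1) • y := fun n => by
          by_cases hn : n < N
          · obtain ⟨y, hy⟩ := hx (n + 1) (by omega)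
            exact ⟨y, fun _ => hy⟩
          · exact ⟨0, fun h => absurd h hn⟩
        choose y hy using h2
        rw [h4, add_zero, hval (fun n => r • y n) fun n hn => by
          rw [hy n hn, pow_succ, mul_smul]]
        refine congrArg Subtype.val ((hker fun n => r ^ n • r • y n).2 fun n _ => ⟨y n, ?_⟩)
        rw [← mul_smul, ← pow_succ]

end Decomposition

/-! ### Presentations, the full decomposition and the converse implications -/

section Presentation

variable {R : Type u} [CommRing R] {r : R}

/-- An `r ^ N`-torsion module with finite projective `(r, μ)`-dévissage is a direct sum of
quotients `P / r ^ n P` with `P` finite projective. -/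
theorem HasMuDevissage.exists_presentation [IsAdicComplete (Ideal.span {r}) R] {N : ℕ} {M : Type u}
    [AddCommGroup M] [Module R M] (h : Module.IsTorsionBy R M (r ^ N)) (hM : HasMuDevissage r M) :
    ∃ (P : Finset.Icc 1 N → FinProjModule R) (f : (∀ i, (P i).carrier) →ₗ[R] M),
      (∀ i, IsFiniteProjectiveOfConstantRank R (P i).carrier) ∧ Function.Surjective f ∧
        ∀ x, f x = 0 ↔ ∀ i, ∃ y, x i = r ^ (i : ℕ) • y := by
  obtain ⟨P, φ, hP, hsurj, hker⟩ :=
    exists_generators_of_pow_smul_eq_zero N M (fun m => @h m) hM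
  -- Summand `i`, of exponent `i`, comes from index `i - 1`.
  let f : (∀ i : Finset.Icc 1 N, (P (i.1 - 1)).carrier) →ₗ[R] M :=
    ∑ i : Finset.Icc 1 N, φ (i.1 - 1) ∘ₗ LinearMap.proj i
  have hf : ∀ (x : ∀ i : Finset.Icc 1 N, (P (i.1 - 1)).carrier) (X : ∀ n, (P n).carrier),
      (∀ n (hn : n + 1 ∈ Finset.Icc 1 N), X n = x ⟨n + 1, hn⟩) →
        f x = ∑ n ∈ Finset.range N, φ n (X n) := fun x X hX => by
    rw [LinearMap.sum_apply]
    symm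
    refine Finset.sum_bij (fun n hn => ⟨n + 1, by simpa using hn⟩) (fun _ _ => Finset.mem_univ _)
      (fun a _ b _ hab => by simpa using hab) (fun i _ => ?_) fun n hn => ?_
    · have := Finset.mem_Icc.1 i.2
      exact ⟨i.1 - 1, Finset.mem_range.2 (by omega), Subtype.ext (by simp; omega)⟩
    · rw [hX n (by simpa using hn)]
      rfl
  refine ⟨fun i => P (i.1 - 1), f, fun i => hP _, fun m => ?_, fun x => ?_⟩
  · obtain ⟨X, hX⟩ := hsurj m
    exact ⟨fun i => X (i.1 - 1), (hf _ X fun _ _ => rfl).trans hX⟩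
  · let X : ∀ n, (P n).carrier := fun n =>
      if hn : n + 1 ∈ Finset.Icc 1 N then x ⟨n + 1, hn⟩ else 0
    have hX : ∀ n (hn : n + 1 ∈ Finset.Icc 1 N), X n = x ⟨n + 1, hn⟩ := fun n hn => dif_pos hn
    rw [hf x X hX, hker]
    constructor
    · rintro H ⟨_ | n, hi⟩
      · simp at hi
      · obtain ⟨y, hy⟩ := H n (Finset.mem_Icc.1 hi).2
        exact ⟨y, (hX n hi).symm.trans hy⟩
    · intro H n hn
      have hi : n + 1 ∈ Finset.Icc 1 N := Finset.mem_Icc.2 ⟨by omega, hn⟩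
      obtain ⟨y, hy⟩ := H ⟨n + 1, hi⟩
      exact ⟨y, (hX n hi).trans hy⟩

theorem HasTorsionDecomposition.hasFullDecomposition [IsAdicComplete (Ideal.span {r}) R]
    {M : Type u} [AddCommGroup M] [Module R M] (h : HasTorsionDecomposition r M) :
    HasFullDecomposition r M := by
  obtain ⟨N, hN, Minf, _, _, Mtors, _, _, hinf, htors, hmu, ⟨e⟩⟩ := h
  obtain ⟨P, f, hP, hf, hker⟩ := hmu.exists_presentation htors
  obtain ⟨e', -⟩ := LinearMap.exists_equiv_of_surjective f hf
    (LinearMap.piMap fun i : Finset.Icc 1 N =>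
      Submodule.mkQ (Ideal.span {r ^ (i : ℕ)} • (⊤ : Submodule R (P i).carrier)))
    (Function.Surjective.piMap fun i => Submodule.mkQ_surjective _) fun x => by
      rw [hker, funext_iff]
      refine forall_congr' fun i => ?_
      refine Iff.trans ?_ (Submodule.Quotient.mk_eq_zero _).symm
      exact (mem_span_singleton_smul_top_iff _ _).symm
  exact ⟨N, hN, Minf, inferInstance, inferInstance,
    fun i => (P i).carrier ⧸ (Ideal.span {r ^ (i : ℕ)} • (⊤ : Submodule R (P i).carrier)),
    inferInstance, inferInstance, hinf,
    fun i => (hP i).quotient _ (Submodule.mkQ_surjective _) (Submodule.ker_mkQ _),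
    ⟨e.trans (LinearEquiv.prodCongr (LinearEquiv.refl R _)
      (e'.trans (DirectSum.linearEquivFunOnFintype R _ _).symm))⟩⟩

theorem IsAdicComplete.span_singleton_pow [IsAdicComplete (Ideal.span {r}) R] {n : ℕ} (hn : 1 ≤ n) :
    IsAdicComplete (Ideal.span {r ^ n}) R where
  haus' x hx := by
    refine IsHausdorff.haus (I := Ideal.span {r}) inferInstance x fun k => ?_
    refine (hx k).mono (Submodule.smul_mono_left (Ideal.pow_right_mono ?_ k))
    exact Ideal.span_singleton_le_span_singleton.2 (dvd_pow_self r (by omega))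
  prec' f hf := by
    have hpow : ∀ k, Ideal.span {r ^ n} ^ k = Ideal.span {r} ^ (n * k) := fun k => by
      rw [← Ideal.span_singleton_pow, pow_mul]
    have hle : ∀ k, k ≤ n * k := fun k => Nat.le_mul_of_pos_left k hn
    simp only [hpow] at *
    obtain ⟨L, hL⟩ := IsPrecomplete.prec (I := Ideal.span {r}) (M := R) inferInstance (f := f)
      fun {a b} hab => (hf hab).mono (Submodule.smul_mono_left (Ideal.pow_le_pow_right (hle a)))
    -- The `r`-adic limit gives `f k ≡ L` only modulo `r ^ k`; passing through `f (n * k)` gives it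
    -- modulo `r ^ (n * k)`.
    exact ⟨L, fun k => (hf (hle k)).trans (hL (n * k))⟩

theorem pow_smul_eq_pow_smul_of_le {P : Type u} [AddCommGroup P] [Module R P]
    (hP : ∀ x : P, r • x = 0 → x = 0) {j n : ℕ} (hjn : j ≤ n) {x y : P}
    (h : r ^ j • x = r ^ n • y) : x = r ^ (n - j) • y := by
  rw [← sub_eq_zero]
  have := pow_smul_eq_zero_of_le (r := r) (N := 0) (n := j) (Nat.zero_le j)
    (fun m hm => by simpa using hP m (by simpa using hm)) (x - r ^ (n - j) • y)
    (by rw [smul_sub, ← mul_smul, ← pow_add, Nat.add_sub_cancel' hjn, h, sub_self])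
  simpa using this

/-- Such an `M` is `P / r^n P` with `P` projective over `R`, hence torsion-free. Cancelling `r ^ j`
identifies the piece with `P / r P` for `j < n`; it vanishes for `n ≤ j`. -/
theorem IsFiniteProjectiveOfConstantRankOverQuotient.hasMuDevissage (hR : IsDevissageSetup R r)
    {n : ℕ} (hn : 1 ≤ n) {M : Type u} [AddCommGroup M] [Module R M]
    (hM : IsFiniteProjectiveOfConstantRankOverQuotient (Ideal.span {r ^ n}) M) :
    HasMuDevissage r M := by
  intro j
  have hrM : ∀ m : M, r ^ n • m = 0 := fun m =>
    hM.1 (x := m) (a := ⟨r ^ n, Ideal.mem_span_singleton_self _⟩)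
  rcases lt_or_ge j n with hj | hj
  · have := hR.complete
    have := IsAdicComplete.span_singleton_pow (R := R) (r := r) hn
    obtain ⟨P, π, hP, hπ, hker⟩ := hM.exists_lift
    have hmem : ∀ x, π x = 0 ↔ ∃ y, x = r ^ n • y := fun x => by
      rw [← LinearMap.mem_ker, hker, mem_span_singleton_smul_top_iff]
    have htf := Module.Projective.eq_zero_of_smul_eq_zero (M := P.carrier) hR.torsion_free
    refine hP.quotient (MuSubquotient.of r M j ∘ₗ π)
      ((MuSubquotient.of_surjective r M j).comp hπ) ?_
    ext x
    rw [LinearMap.mem_ker, LinearMap.comp_apply, MuSubquotient.of_eq_zero_iff,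
      mem_span_singleton_smul_top_iff]
    constructor
    · rintro ⟨y, hy⟩
      obtain ⟨y, rfl⟩ := hπ y
      rw [← map_smul, ← map_smul, ← sub_eq_zero, ← map_sub, hmem] at hy
      obtain ⟨z, hz⟩ := hy
      rw [pow_succ, mul_smul, ← smul_sub] at hz
      have := pow_smul_eq_pow_smul_of_le htf hj.le hz
      refine ⟨y + r ^ (n - j - 1) • z, ?_⟩
      rw [smul_add, ← mul_smul, ← pow_succ', Nat.sub_add_cancel (by omega), ← this]
      abel
    · rintro ⟨y, rfl⟩
      exact ⟨π y, by rw [map_smul, ← mul_smul, ← pow_succ]⟩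
  · have : Subsingleton (MuSubquotient r M j) := by
      refine subsingleton_of_forall_eq 0 fun x => ?_
      obtain ⟨m, rfl⟩ := MuSubquotient.of_surjective r M j x
      refine (MuSubquotient.of_eq_zero_iff r j m).2 ⟨0, ?_⟩
      rw [smul_zero, ← Nat.sub_add_cancel hj, pow_add, mul_smul, hrM, smul_zero]
    exact of_subsingleton

theorem HasFullDecomposition.hasTorsionDecomposition (hR : IsDevissageSetup R r) {M : Type u}
    [AddCommGroup M] [Module R M] (h : HasFullDecomposition r M) : HasTorsionDecomposition r M := by
  obtain ⟨N, hN, Minf, _, _, Mfin, _, _, hinf, hfin, ⟨e⟩⟩ := h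
  refine ⟨N, hN, Minf, inferInstance, inferInstance, ∀ i, Mfin i, inferInstance, inferInstance,
    hinf, fun {x} => funext fun i => ?_,
    HasMuDevissage.pi fun i => (hfin i).hasMuDevissage hR (Finset.mem_Icc.1 i.2).1,
    ⟨e.trans (LinearEquiv.prodCongr (LinearEquiv.refl R _)
      (DirectSum.linearEquivFunOnFintype R _ _))⟩⟩
  change r ^ N • x i = 0
  have h1 : r ^ (i : ℕ) • x i = 0 :=
    (hfin i).1 (x := x i) (a := ⟨r ^ (i : ℕ), Ideal.mem_span_singleton_self _⟩)
  rw [← Nat.sub_add_cancel (Finset.mem_Icc.1 i.2).2, pow_add, mul_smul, h1, smul_zero]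

/-- A two-term resolution by finite projective modules, invertible up to a power of `r`. -/
theorem HasTorsionDecomposition.exists_resolution [IsAdicComplete (Ideal.span {r}) R] {M : Type u}
    [AddCommGroup M] [Module R M] (h : HasTorsionDecomposition r M) :
    ∃ (N : ℕ) (A B : FinProjModule R) (δ : A.carrier →ₗ[R] B.carrier) (f : B.carrier →ₗ[R] M)
      (δ' : B.carrier →ₗ[R] A.carrier),
      Function.Exact δ f ∧ Function.Surjective f ∧ δ' ∘ₗ δ = r ^ N • LinearMap.id := by
  obtain ⟨N, -, Minf, _, _, Mtors, _, _, hinf, htors, hmu, ⟨e⟩⟩ := h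
  obtain ⟨P, f, hP, hf, hker⟩ := hmu.exists_presentation htors
  have hPi := IsFiniteProjectiveOfConstantRank.pi hP
  have h1 := hPi.1
  have h2 := hPi.2.1
  have h3 := hinf.1
  have h4 := hinf.2.1
  -- The differential is `r ^ i` on the factor `P i`, and `r ^ (N - i)` completes it to `r ^ N`.
  refine ⟨N, ⟨∀ i, (P i).carrier⟩, ⟨Minf × ∀ i, (P i).carrier⟩,
    LinearMap.inr R _ _ ∘ₗ LinearMap.piMap fun i => r ^ (i : ℕ) • LinearMap.id,
    e.symm.toLinearMap ∘ₗ LinearMap.id.prodMap f,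
    (LinearMap.piMap fun i => r ^ (N - (i : ℕ)) • LinearMap.id) ∘ₗ LinearMap.snd R _ _,
    ?_, e.symm.surjective.comp (Prod.map_surjective.2 ⟨Function.surjective_id, hf⟩), ?_⟩
  · rintro ⟨a, x⟩
    change e.symm (a, f x) = 0 ↔ _
    rw [LinearEquiv.map_eq_zero_iff, Prod.mk_eq_zero, hker]
    constructor
    · rintro ⟨rfl, hx⟩
      choose y hy using hx
      exact ⟨y, Prod.ext rfl (funext fun i => (hy i).symm)⟩
    · rintro ⟨y, hy⟩
      exact ⟨(congrArg Prod.fst hy).symm,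
        fun i => ⟨y i, (congrFun (congrArg Prod.snd hy) i).symm⟩⟩
  · refine LinearMap.ext fun x => funext fun i => ?_
    change r ^ (N - (i : ℕ)) • r ^ (i : ℕ) • x i = r ^ N • x i
    rw [← mul_smul, ← pow_add, Nat.sub_add_cancel (Finset.mem_Icc.1 i.2).2]

theorem HasTorsionDecomposition.finitePresentation [IsAdicComplete (Ideal.span {r}) R] {M : Type u}
    [AddCommGroup M] [Module R M] (h : HasTorsionDecomposition r M) :
    Module.FinitePresentation R M := by
  obtain ⟨N, A, B, δ, f, -, hδf, hf, -⟩ := h.exists_resolution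
  have := Module.finitePresentation_of_projective R B.carrier
  refine Module.finitePresentation_of_surjective f hf ?_
  rw [LinearMap.exact_iff.1 hδf, LinearMap.range_eq_map]
  exact Module.Finite.fg_top.map δ

/-- Precompleteness follows from finiteness over `R`; separatedness is checked on the projective and
the torsion summand. -/
theorem HasTorsionDecomposition.isAdicComplete [IsAdicComplete (Ideal.span {r}) R] {M : Type u}
    [AddCommGroup M] [Module R M] (h : HasTorsionDecomposition r M) :
    IsAdicComplete (Ideal.span {r}) M := by
  have := h.finitePresentation
  obtain ⟨N, -, Minf, _, _, Mtors, _, _, hinf, htors, -, ⟨e⟩⟩ := h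
  have := hinf.2.1
  have := IsHausdorff.of_projective (M := Minf) (Ideal.span {r})
  have := IsHausdorff.of_isTorsionBy htors
  have := IsHausdorff.prod (M := Minf) (N := Mtors) (Ideal.span {r})
  exact { toIsHausdorff := IsHausdorff.congr _ e.symm
          toIsPrecomplete := IsPrecomplete.of_finite _ }

theorem HasTorsionDecomposition.hasMuDevissage (hR : IsDevissageSetup R r) {M : Type u}
    [AddCommGroup M] [Module R M] (h : HasTorsionDecomposition r M) : HasMuDevissage r M := by
  obtain ⟨N, -, Minf, _, _, Mtors, _, _, hinf, htors, hmu, ⟨e⟩⟩ := h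
  have := hinf.2.1
  exact ((HasMuDevissage.of_torsionFree hinf
    (Module.Projective.eq_zero_of_smul_eq_zero hR.torsion_free)).prod hmu).congr e.symm

end Presentation

/-! ### Vanishing of `Tor` -/

section Tor

variable {R : Type u} [CommRing R] {r : R}

open LinearMap in
/-- Degree one exactness after tensoring a resolution `C₂ → C₁ → C₀ → P` of an `r`-torsion-free
module `P` with a module admitting a flat resolution that is split up to a power of `r`. -/
theorem exact_lTensor_of_torsionFree {M A B C₀ C₁ C₂ P : Type u}
    [AddCommGroup M] [Module R M] [AddCommGroup A] [Module R A] [AddCommGroup B] [Module R B]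
    [AddCommGroup C₀] [Module R C₀] [AddCommGroup C₁] [Module R C₁] [AddCommGroup C₂] [Module R C₂]
    [AddCommGroup P] [Module R P] [Module.Flat R A] [Module.Flat R B]
    {δ : A →ₗ[R] B} {f : B →ₗ[R] M} {δ' : B →ₗ[R] A} {N : ℕ} (hδf : Function.Exact δ f)
    (hf : Function.Surjective f) (hδ' : δ' ∘ₗ δ = r ^ N • LinearMap.id)
    {d₂ : C₂ →ₗ[R] C₁} {d₁ : C₁ →ₗ[R] C₀} {ε : C₀ →ₗ[R] P} (h₂ : Function.Exact d₂ d₁)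
    (h₁ : Function.Exact d₁ ε) (hε : Function.Surjective ε) (hP : ∀ x : P, r • x = 0 → x = 0) :
    Function.Exact (d₂.lTensor M) (d₁.lTensor M) := by
  have hinjP : Function.Injective (LinearMap.lsmul R P (r ^ N)) := by
    refine (injective_iff_map_eq_zero _).2 fun x hx => ?_
    simpa using pow_smul_eq_zero_of_le (r := r) (N := 0) (Nat.zero_le N)
      (fun m hm => by simpa using hP m (by simpa using hm)) x hx
  -- `A ⊗ P` has no `r ^ N`-torsion, as `A` is flat and `P` torsion-free; since `δ'` after `δ` is `r
  -- ^ N`, the map `δ ⊗ P` is injective.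
  have hinj : ∀ t, δ.rTensor P t = 0 → t = 0 := fun t ht => by
    have h1 := Module.Flat.lTensor_preserves_injective_linearMap (M := A) _ hinjP
    refine (injective_iff_map_eq_zero _).1 h1 t ?_
    have h2 : (LinearMap.lsmul R P (r ^ N)).lTensor A = δ'.rTensor P ∘ₗ δ.rTensor P := by
      rw [← rTensor_comp, hδ']
      ext a p
      simp
    rw [h2, comp_apply, ht, map_zero]
  have comm : ∀ {U V X Y : Type u} [AddCommGroup U] [Module R U] [AddCommGroup V] [Module R V]
      [AddCommGroup X] [Module R X] [AddCommGroup Y] [Module R Y] (g : U →ₗ[R] V) (d : X →ₗ[R] Y) t,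
      d.lTensor V (g.rTensor X t) = g.rTensor Y (d.lTensor U t) := fun g d t => by
    rw [← comp_apply, ← comp_apply, lTensor_comp_rTensor, rTensor_comp_lTensor]
  intro z
  constructor
  · intro hz
    -- Lift the cycle to `b` in `B ⊗ C₁`. Its boundary comes from some `a` in `A ⊗ C₀`, which dies
    -- in `A ⊗ P` by `hinj` and so equals the boundary of some `a'`. Subtracting the image of `a'`
    -- makes `b` a cycle, hence a boundary since `B` is flat, without changing its image over `M`.
    obtain ⟨b, rfl⟩ := rTensor_surjective C₁ hf z
    rw [comm] at hz
    obtain ⟨a, ha⟩ := (rTensor_exact C₀ hδf hf _).1 hz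
    have h3 : ε.lTensor A a = 0 := hinj _ <| by
      rw [← comm, ha]
      exact (lTensor_exact B h₁ hε _).2 ⟨b, rfl⟩
    obtain ⟨a', rfl⟩ := (lTensor_exact A h₁ hε a).1 h3
    obtain ⟨c, hc⟩ := (Module.Flat.lTensor_exact B h₂ (b - δ.rTensor C₁ a')).1
      (by rw [map_sub, comm, ha, sub_self])
    refine ⟨f.rTensor C₂ c, ?_⟩
    rw [comm, hc, map_sub, sub_eq_self]
    exact (rTensor_exact C₁ hδf hf _).2 ⟨a', rfl⟩
  · rintro ⟨y, rfl⟩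
    rw [← comp_apply, ← lTensor_comp, h₂.linearMap_comp_eq_zero, lTensor_zero, LinearMap.zero_apply]

open CategoryTheory in
-- `Tor` is computed from a projective resolution of the second argument `P`, so vanishing in degree
-- one is exactness at `C₁` after tensoring with `M`.
theorem isZero_tor_one_of_exact_lTensor {M P : Type u} [AddCommGroup M] [Module R M]
    [AddCommGroup P] [Module R P]
    (H : ∀ {C₀ C₁ C₂ : Type u} [AddCommGroup C₀] [Module R C₀] [AddCommGroup C₁] [Module R C₁]
      [AddCommGroup C₂] [Module R C₂] (d₂ : C₂ →ₗ[R] C₁) (d₁ : C₁ →ₗ[R] C₀) (ε : C₀ →ₗ[R] P),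
      Function.Exact d₂ d₁ → Function.Exact d₁ ε → Function.Surjective ε →
        Function.Exact (d₂.lTensor M) (d₁.lTensor M)) :
    Limits.IsZero (((Tor (ModuleCat.{u} R) 1).obj (ModuleCat.of R M)).obj (ModuleCat.of R P)) := by
  let Q := projectiveResolution (ModuleCat.of R P)
  refine Limits.IsZero.of_iso ?_ (Q.isoLeftDerivedObj
    ((MonoidalCategory.tensoringLeft (ModuleCat.{u} R)).obj (ModuleCat.of R M)) 1)
  refine HomologicalComplex.ExactAt.isZero_homology ?_
  rw [HomologicalComplex.exactAt_iff' _ 2 1 0 (by simp) (by simp)]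
  rw [ShortComplex.ShortExact.moduleCat_exact_iff_function_exact]
  have h2 : Function.Exact (Q.complex.d 2 1).hom (Q.complex.d 1 0).hom := by
    have := Q.exact_succ 0
    rwa [ShortComplex.ShortExact.moduleCat_exact_iff_function_exact] at this
  have h1 : Function.Exact (Q.complex.d 1 0).hom (Q.π.f 0).hom := by
    have := Q.exact₀
    rwa [ShortComplex.ShortExact.moduleCat_exact_iff_function_exact] at this
  have h0 : Function.Surjective (Q.π.f 0).hom :=
    (ModuleCat.epi_iff_surjective _).1 inferInstance
  exact H _ _ _ h2 h1 h0

end Tor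
-- The equivalences assembled
theorem theorem4p3 {R : Type u} [CommRing R] (r : R) (hR : IsDevissageSetup R r)
    (M : Type u) [AddCommGroup M] [Module R M] :
    List.TFAE [
      IsAdicComplete (Ideal.span {r}) M ∧ HasMuDevissage r M,
      Module.FinitePresentation R M ∧ HasMuDevissage r M ∧ HasBoundedTorsion r M,
      HasTorsionDecomposition r M] ∧
    (IsAdicComplete (Ideal.span {r}) M ∧ HasMuDevissage r M →
      (∀ (P : Type u) [AddCommGroup P] [Module R P], Submodule.torsionBy R P r = ⊥ →
        CategoryTheory.Limits.IsZero
          (((CategoryTheory.Tor (ModuleCat.{u} R) 1).obj (ModuleCat.of R M)).obj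
            (ModuleCat.of R P))) ∧
      HasTauDevissage r M) ∧
    (K0EqInt (R ⧸ Ideal.span {r}) →
      List.TFAE [
        IsAdicComplete (Ideal.span {r}) M ∧ HasMuDevissage r M,
        Module.FinitePresentation R M ∧ HasMuDevissage r M ∧ HasBoundedTorsion r M,
        HasTorsionDecomposition r M,
        HasFullDecomposition r M]) := by
  have := hR.complete
  have h13 : IsAdicComplete (Ideal.span {r}) M ∧ HasMuDevissage r M →
      HasTorsionDecomposition r M := fun ⟨_, hM⟩ =>
    have := hM.finite
    hM.hasTorsionDecomposition hM.hasBoundedTorsion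
  have h31 : HasTorsionDecomposition r M →
      IsAdicComplete (Ideal.span {r}) M ∧ HasMuDevissage r M := fun h =>
    ⟨h.isAdicComplete, h.hasMuDevissage hR⟩
  have h32 : HasTorsionDecomposition r M →
      Module.FinitePresentation R M ∧ HasMuDevissage r M ∧ HasBoundedTorsion r M := fun h =>
    have := h.isAdicComplete
    ⟨h.finitePresentation, h.hasMuDevissage hR, (h.hasMuDevissage hR).hasBoundedTorsion⟩
  have h23 : Module.FinitePresentation R M ∧ HasMuDevissage r M ∧ HasBoundedTorsion r M →
      HasTorsionDecomposition r M := fun ⟨_, hM, hb⟩ => hM.hasTorsionDecomposition hb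
  refine ⟨?_, fun h => ⟨fun P _ _ hP => ?_, ?_⟩, fun _ => ?_⟩
  · tfae_have 1 → 3 := h13
    tfae_have 3 → 1 := h31
    tfae_have 3 → 2 := h32
    tfae_have 2 → 3 := h23
    tfae_finish
  · obtain ⟨N, A, B, δ, f, δ', hδf, hf, hδ'⟩ := (h13 h).exists_resolution
    refine isZero_tor_one_of_exact_lTensor fun d₂ d₁ ε h₂ h₁ hε =>
      exact_lTensor_of_torsionFree hδf hf hδ' h₂ h₁ hε fun x hx => ?_
    exact (Submodule.mem_bot R).1 (hP ▸ (Submodule.mem_torsionBy_iff r x).2 hx)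
  · have := h.1
    exact h.2.hasTauDevissage h.2.hasBoundedTorsion
  · tfae_have 1 → 3 := h13
    tfae_have 3 → 1 := h31
    tfae_have 3 → 2 := h32
    tfae_have 2 → 3 := h23
    tfae_have 3 → 4 := fun h => h.hasFullDecomposition
    tfae_have 4 → 3 := fun h => h.hasTorsionDecomposition hR
    tfae_finish
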